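/- For positive integers $d,n$ and $x_1,\dots,x_d\in M_n(\mathbb C)$ put $$|||\{x_i\}_{i=1}^d|||^*:=\inf\Big\{\mathrm{Tr}\Big(\big(\textstyle\sum_{i=1}^d y_i^*y_i\big)^{1/2}+\big(\sum_{i=1}^d z_iz_i^*\big)^{1/2}\Big)\;:\; x_i=y_i+z_i,\ y_i,z_i\in M_n(\mathbb C)\Big\},$$ where $\mathrm{Tr}$ is the non-normalized trace, and let $S_1^n$ be $M_n(\mathbb C)$ with the norm $\|x\|_1=\mathrm{Tr}((x^*x)^{1/2})$. A complex random variable is called standard Gaussian if it has density $\frac1\pi e^{-|z|^2}$ with respect to Lebesgue measure $d\,\mathrm{Re}\,z\,d\,\mathrm{Im}\,z$ on $\mathbb C$. For each $d$ let $\gamma_1,\dots,\gamma_d$ be independent standard complex Gaussian random variables on a probability space $(\Omega,\mathbb P)$ (the space and the variables may depend on $d$; in particular they may be the first $d$ terms of one infinite independent sequence). Then $\sum_{i=1}^d x_i\otimes\gamma_i$ lies in $L^1(\Omega;S_1^n)$ for all $d,n\ge 1$ and all $x_1,\dots,x_d\in M_n(\mathbb C)$, where $$\Big\|\sum_{i=1}^d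 x_i\otimes\gamma_i\Big\|_{L^1(\Omega;S_1^n)}=\int_\Omega\Big\|\sum_{i=1}^d\gamma_i(\omega)x_i\Big\|_1\,d\mathbb P(\omega).$$ Let $c_1$ be the largest and $c_2$ the smallest real constant such that $$c_1\,|||\{x_i\}_{i=1}^d|||^*\;\le\;\Big\|\sum_{i=1}^d x_i\otimes\gamma_i\Big\|_{L^1(\Omega;S_1^n)}\;\le\;c_2\,|||\{x_i\}_{i=1}^d|||^*$$ for all positive integers $d,n$ and all $x_1,\dots,x_d\in M_n(\mathbb C)$. Then these best constants exist and $$c_1=\frac1{\sqrt2},\qquad c_2=1.$$ -/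

import Mathlib

open MeasureTheory ProbabilityTheory

noncomputable section

namespace NCKhintchine

/-- The standard complex Gaussian law: density `π⁻¹ exp (-|z|²)` with respect to the Lebesgue
measure `dRe z dIm z` on `ℂ`. -/
def stdComplexGaussian : Measure ℂ :=
  volume.withDensity fun z => ENNReal.ofReal (Real.pi⁻¹ * Real.exp (-‖z‖ ^ 2))

/-- `γ` is a finite family of independent standard complex-valued Gaussian random variables on
the probability space `(Ω, P)`. -/
structure IsIndepStdComplexGaussian {Ω : Type*} [MeasurableSpace Ω] {d : ℕ}
    (γ : Fin d → Ω → ℂ) (P : Measure Ω) : Prop where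
  hasLaw : ∀ i, HasLaw (γ i) stdComplexGaussian P
  indep : iIndepFun γ P

section MatrixNorms

open scoped MatrixOrder

variable {n d : ℕ}

/-- `Tr (A ^ (1/2))` for a positive semidefinite matrix `A`; `Tr` is the non-normalized trace, and
the square root is that of the continuous functional calculus. -/
def trSqrt (A : Matrix (Fin n) (Fin n) ℂ) : ℝ :=
  (CFC.sqrt A).trace.re

open scoped Matrix in
/-- The trace norm `‖A‖₁ = Tr ((A* A) ^ (1/2))`, that is, the norm of `S_1^n`. -/
def traceNorm (A : Matrix (Fin n) (Fin n) ℂ) : ℝ :=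
  trSqrt (Aᴴ * A)

open scoped Matrix in
/-- The norm `|||{x_i}|||^*`: the infimum of
`Tr ((∑ y_i* y_i) ^ (1/2) + (∑ z_i z_i*) ^ (1/2))` over all decompositions `x_i = y_i + z_i`. -/
def dualNorm (x : Fin d → Matrix (Fin n) (Fin n) ℂ) : ℝ :=
  sInf {t : ℝ | ∃ y z : Fin d → Matrix (Fin n) (Fin n) ℂ, (∀ i, x i = y i + z i) ∧
    t = trSqrt (∑ i, (y i)ᴴ * y i) + trSqrt (∑ i, z i * (z i)ᴴ)}

/-- The matrix-valued random variable `∑ x_i ⊗ γ_i`. -/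
def randomSum {Ω : Type*} (x : Fin d → Matrix (Fin n) (Fin n) ℂ) (γ : Fin d → Ω → ℂ) (ω : Ω) :
    Matrix (Fin n) (Fin n) ℂ :=
  ∑ i, γ i ω • x i

/-- The norm of `Y` in `L¹(Ω; S_1^n)`. -/
def L1Norm {Ω : Type*} [MeasurableSpace Ω] (P : Measure Ω)
    (Y : Ω → Matrix (Fin n) (Fin n) ℂ) : ℝ :=
  ∫ ω, traceNorm (Y ω) ∂P

end MatrixNorms

end NCKhintchine

end

/-! Upper bound. For a column part `y`, let `u_k` be an orthonormal eigenbasis of `∑ y_i* y_i` with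
eigenvalues `l_k`, and let `Y = ∑ γ_i y_i`. Then `‖Y‖₁ ≤ ∑ ‖Y u_k‖`, and Jensen together with `E ‖Y
u_k‖² = l_k` gives `E ‖Y‖₁ ≤ ∑ √l_k`. Row parts follow by taking adjoints
(`L1Norm_randomSum_le_dualNorm`).

Lower bound. By Hahn–Banach, `|||x|||^* = Re ∑ Tr (b_i* x_i)` for some `b` with `∑ b_i* b_i ≤ 1` and
`∑ b_i b_i* ≤ 1`. With `Y = ∑ γ_i b_i` and `X = ∑ γ_i x_i` this equals `Re E Tr (Y* X)`. Split `Y =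
T + R` with `T = Y (1 + Y* Y / 2)⁻¹`. On singular values, `t / (1 + t²/2) ≤ 1/√2`, and the error is
`t²/2` times that quantity, so `R* R ≤ (Y* Y)² / 8`. Wick's formula gives `E (Y* Y)² ≤ 2`, hence `E
R* R ≤ 1/4`. By Bessel, the Gaussian coefficients of `R` form a family whose double is again
bicontractive. So `|||x|||^* ≤ ‖X‖_{L¹} / √2 + |||x|||^* / 2`, which is the constant `1/√2`
(`dualNorm_le_L1Norm_randomSum`).

Sharpness. For the matrix units of one column the trace norm is the Euclidean length of the Gaussian
vector, which concentrates around the square root of its dimension; this forces `c₂ ≥ 1`. For `c₁`,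
take `2d + 1` fermionic annihilation operators restricted to the particle level `d + 1`. The
anticommutation relations make every combination `∑ γ_i x_i` a multiple of a partial isometry of
fixed rank, while row and column square sums are both `d + 1` times projections. Comparing the two
norms gives `c₁² ≤ (d + 1) / (2d + 1)`, which tends to `1/2`. -/

noncomputable section
namespace NCKhintchine

open Matrix
open scoped MatrixOrder ComplexOrder

/-! ### Trace of the square root, column duality and the trace norm. -/

section TraceSqrt

variable {n : ℕ} {ι : Type*} [Fintype ι]

/-- A positive semidefinite matrix is unitarily diagonalizable with nonnegative eigenvalues. -/
lemma exists_unitary_diagonal {A : Matrix (Fin n) (Fin n) ℂ} (hA : A.PosSemidef) :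
    ∃ (U : Matrix (Fin n) (Fin n) ℂ) (l : Fin n → ℝ), Uᴴ * U = 1 ∧ U * Uᴴ = 1 ∧ (∀ k, 0 ≤ l k) ∧
      A = U * diagonal (fun k => (l k : ℂ)) * Uᴴ := by
  refine ⟨hA.isHermitian.eigenvectorUnitary, hA.isHermitian.eigenvalues, ?_, ?_,
    hA.eigenvalues_nonneg, ?_⟩
  · exact Unitary.coe_star_mul_self _
  · exact Unitary.coe_mul_star_self _
  · have := hA.isHermitian.spectral_theorem
    rwa [Unitary.conjStarAlgAut_apply] at this

lemma sum_conjTranspose_mul_self_posSemidef (y : ι → Matrix (Fin n) (Fin n) ℂ) :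
    (∑ i, (y i)ᴴ * y i).PosSemidef :=
  posSemidef_sum _ fun i _ => posSemidef_conjTranspose_mul_self (y i)

lemma sqrt_unitary_diagonal {U : Matrix (Fin n) (Fin n) ℂ} {l : Fin n → ℝ} (h1 : Uᴴ * U = 1)
    (hl : ∀ k, 0 ≤ l k) :
    CFC.sqrt (U * diagonal (fun k => (l k : ℂ)) * Uᴴ) =
      U * diagonal (fun k => (Real.sqrt (l k) : ℂ)) * Uᴴ := by
  apply CFC.sqrt_unique
  · rw [show U * diagonal (fun k => (Real.sqrt (l k) : ℂ)) * Uᴴ *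
      (U * diagonal (fun k => (Real.sqrt (l k) : ℂ)) * Uᴴ) =
      U * diagonal (fun k => (Real.sqrt (l k) : ℂ)) * (Uᴴ * U) *
        diagonal (fun k => (Real.sqrt (l k) : ℂ)) * Uᴴ by simp only [Matrix.mul_assoc]]
    rw [h1, Matrix.mul_one, Matrix.mul_assoc U, diagonal_mul_diagonal]
    congr 3
    ext k
    rw [← Complex.ofReal_mul, Real.mul_self_sqrt (hl k)]
  · rw [nonneg_iff_posSemidef]
    apply PosSemidef.mul_mul_conjTranspose_same
    apply PosSemidef.diagonal
    intro k
    simp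

lemma trace_unitary_diagonal {U : Matrix (Fin n) (Fin n) ℂ} {l : Fin n → ℝ} (h1 : Uᴴ * U = 1) :
    (U * diagonal (fun k => (l k : ℂ)) * Uᴴ).trace = ((∑ k, l k : ℝ) : ℂ) := by
  rw [Matrix.trace_mul_comm, ← Matrix.mul_assoc, h1, Matrix.one_mul, trace_diagonal]
  push_cast
  rfl

lemma trSqrt_unitary_diagonal {U : Matrix (Fin n) (Fin n) ℂ} {l : Fin n → ℝ} (h1 : Uᴴ * U = 1)
    (hl : ∀ k, 0 ≤ l k) :
    trSqrt (U * diagonal (fun k => (l k : ℂ)) * Uᴴ) = ∑ k, Real.sqrt (l k) := by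
  rw [trSqrt, sqrt_unitary_diagonal h1 hl, trace_unitary_diagonal h1, Complex.ofReal_re]

lemma trSqrt_nonneg (A : Matrix (Fin n) (Fin n) ℂ) : 0 ≤ trSqrt A := by
  have h := (nonneg_iff_posSemidef.1 (CFC.sqrt_nonneg A)).trace_nonneg
  exact (Complex.le_def.1 h).1

/-- The hypothesis makes `A` equal to `s²` times a projection, so its square root is `A / s`. -/
lemma trSqrt_of_mul_self {A : Matrix (Fin n) (Fin n) ℂ} (hA : A.PosSemidef) {s : ℝ} (hs : 0 < s)
    (h : A * A = ((s ^ 2 : ℝ) : ℂ) • A) : trSqrt A = A.trace.re / s := by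
  have : CFC.sqrt A = ((s⁻¹ : ℝ) : ℂ) • A := by
    apply CFC.sqrt_unique
    · rw [smul_mul_smul_comm, h, smul_smul]
      rw [← Complex.ofReal_mul, ← Complex.ofReal_mul]
      rw [show s⁻¹ * s⁻¹ * s ^ 2 = 1 by field_simp]
      simp
    · rw [nonneg_iff_posSemidef]
      exact hA.smul (by
        rw [Complex.zero_le_real]; positivity)
  rw [trSqrt, this, trace_smul, smul_eq_mul, Complex.re_ofReal_mul]
  field_simp

lemma trSqrt_zero : trSqrt (0 : Matrix (Fin n) (Fin n) ℂ) = 0 := by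
  simp [trSqrt]

lemma trSqrt_smul {A : Matrix (Fin n) (Fin n) ℂ} (hA : A.PosSemidef) {c : ℝ} (hc : 0 ≤ c) :
    trSqrt (((c ^ 2 : ℝ) : ℂ) • A) = c * trSqrt A := by
  obtain ⟨U, l, h1, -, hl, rfl⟩ := exists_unitary_diagonal hA
  have : ((c ^ 2 : ℝ) : ℂ) • (U * diagonal (fun k => (l k : ℂ)) * Uᴴ) =
      U * diagonal (fun k => ((c ^ 2 * l k : ℝ) : ℂ)) * Uᴴ := by
    rw [← Matrix.smul_mul, ← Matrix.mul_smul]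
    congr 2
    ext i j
    simp [diagonal_apply]
  rw [this, trSqrt_unitary_diagonal h1 (fun k => mul_nonneg (sq_nonneg c) (hl k)),
    trSqrt_unitary_diagonal h1 hl, Finset.mul_sum]
  refine Finset.sum_congr rfl fun k _ => ?_
  rw [Real.sqrt_mul (sq_nonneg c), Real.sqrt_sq hc]

/-- The real trace pairing `Re ∑ Tr (b_i* x_i)` of two families of matrices. -/
def pairing (b x : ι → Matrix (Fin n) (Fin n) ℂ) : ℝ := (∑ i, ((b i)ᴴ * x i).trace).re

lemma trace_conjTranspose_mul (C D : Matrix (Fin n) (Fin n) ℂ) :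
    (Cᴴ * D).trace = ∑ k, ∑ m, star (C m k) * D m k := by
  simp [Matrix.trace, Matrix.mul_apply]

lemma re_sum_conjTranspose_mul_self_apply (C : ι → Matrix (Fin n) (Fin n) ℂ) (k : Fin n) :
    ((∑ i, (C i)ᴴ * C i) k k).re = ∑ p : ι × Fin n, ‖C p.1 p.2 k‖ ^ 2 := by
  rw [Fintype.sum_prod_type, Matrix.sum_apply, Complex.re_sum]
  refine Finset.sum_congr rfl fun i _ => ?_
  rw [Matrix.mul_apply, Complex.re_sum]
  refine Finset.sum_congr rfl fun m _ => ?_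
  rw [conjTranspose_apply, Complex.star_def, ← Complex.normSq_eq_conj_mul_self,
    Complex.ofReal_re, Complex.normSq_eq_norm_sq]

/-- Columnwise Cauchy–Schwarz inequality for the trace pairing. -/
lemma pairing_le_sum_sqrt (C D : ι → Matrix (Fin n) (Fin n) ℂ) :
    pairing C D ≤ ∑ k, Real.sqrt ((∑ i, (C i)ᴴ * C i) k k).re *
      Real.sqrt ((∑ i, (D i)ᴴ * D i) k k).re := by
  have h : pairing C D = ∑ k, ∑ p : ι × Fin n, (star (C p.1 p.2 k) * D p.1 p.2 k).re := by
    simp only [pairing, trace_conjTranspose_mul, Complex.re_sum, Fintype.sum_prod_type]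
    rw [Finset.sum_comm]
  rw [h]
  refine Finset.sum_le_sum fun k _ => ?_
  rw [re_sum_conjTranspose_mul_self_apply, re_sum_conjTranspose_mul_self_apply]
  refine le_trans (Finset.sum_le_sum fun p _ => ?_)
    (Real.sum_mul_le_sqrt_mul_sqrt Finset.univ (fun p : ι × Fin n => ‖C p.1 p.2 k‖)
      (fun p : ι × Fin n => ‖D p.1 p.2 k‖))
  refine (Complex.re_le_norm _).trans ?_
  rw [norm_mul, norm_star]

lemma pairing_mul_unitary (b y : ι → Matrix (Fin n) (Fin n) ℂ) {U : Matrix (Fin n) (Fin n) ℂ}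
    (h2 : U * Uᴴ = 1) : pairing (fun i => b i * U) (fun i => y i * U) = pairing b y := by
  unfold pairing
  congr 1
  refine Finset.sum_congr rfl fun i _ => ?_
  rw [conjTranspose_mul, Matrix.mul_assoc, Matrix.trace_mul_comm, Matrix.mul_assoc, Matrix.mul_assoc,
    h2, Matrix.mul_one]

lemma sum_conjTranspose_mul_unitary (y : ι → Matrix (Fin n) (Fin n) ℂ)
    (U : Matrix (Fin n) (Fin n) ℂ) :
    ∑ i, (y i * U)ᴴ * (y i * U) = Uᴴ * (∑ i, (y i)ᴴ * y i) * U := by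
  rw [Finset.mul_sum, Finset.sum_mul]
  simp only [conjTranspose_mul, Matrix.mul_assoc]

/-- The column norm of the family `b` is at most `1`. -/
def ColContractive (b : ι → Matrix (Fin n) (Fin n) ℂ) : Prop :=
  (1 - ∑ i, (b i)ᴴ * b i).PosSemidef

/-- In an eigenbasis of `∑ y_i* y_i` the columns of `y` have lengths `√l_k`, and those of `b` have
length at most `1`; columnwise Cauchy–Schwarz concludes. -/
lemma ColContractive.pairing_le {b : ι → Matrix (Fin n) (Fin n) ℂ} (hb : ColContractive b)
    (y : ι → Matrix (Fin n) (Fin n) ℂ) : pairing b y ≤ trSqrt (∑ i, (y i)ᴴ * y i) := by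
  obtain ⟨U, l, h1, h2, hl, hA⟩ := exists_unitary_diagonal (sum_conjTranspose_mul_self_posSemidef y)
  rw [hA, trSqrt_unitary_diagonal h1 hl, ← pairing_mul_unitary b y h2]
  refine (pairing_le_sum_sqrt _ _).trans (Finset.sum_le_sum fun k _ => ?_)
  rw [sum_conjTranspose_mul_unitary, sum_conjTranspose_mul_unitary, hA]
  have e : Uᴴ * (U * diagonal (fun k => (l k : ℂ)) * Uᴴ) * U = diagonal (fun k => (l k : ℂ)) := by
    rw [← Matrix.mul_assoc, ← Matrix.mul_assoc, h1, Matrix.one_mul, Matrix.mul_assoc, h1,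
      Matrix.mul_one]
  rw [e, diagonal_apply_eq, Complex.ofReal_re]
  have h := (hb.conjTranspose_mul_mul_same U).diag_nonneg (i := k)
  rw [Matrix.mul_sub, Matrix.sub_mul, Matrix.mul_one, h1, Matrix.sub_apply, one_apply_eq] at h
  have h' := (Complex.le_def.1 h).1
  simp only [Complex.zero_re, Complex.sub_re, Complex.one_re] at h'
  exact mul_le_of_le_one_left (Real.sqrt_nonneg _) (Real.sqrt_le_one.2 (by linarith))

/-- Polar decomposition: with `A = ∑ y_i* y_i`, the maximizer is `b_i = y_i A^{-1/2}`. -/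
lemma exists_colContractive_pairing_eq (y : ι → Matrix (Fin n) (Fin n) ℂ) :
    ∃ b, ColContractive b ∧ pairing b y = trSqrt (∑ i, (y i)ᴴ * y i) := by
  obtain ⟨U, l, h1, h2, hl, hA⟩ := exists_unitary_diagonal (sum_conjTranspose_mul_self_posSemidef y)
  -- Since `0⁻¹ = 0`, this is the pseudo-inverse of the square root, so a singular sum needs no
  -- separate treatment.
  set W : Matrix (Fin n) (Fin n) ℂ := U * diagonal (fun k => ((Real.sqrt (l k))⁻¹ : ℂ)) * Uᴴ with hW
  have hWs : Wᴴ = W := by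
    rw [hW]
    simp only [conjTranspose_mul, conjTranspose_conjTranspose, diagonal_conjTranspose,
      Matrix.mul_assoc]
    congr 3
    ext k
    simp
  have hmul : ∀ f g : Fin n → ℂ, (U * diagonal f * Uᴴ) * (U * diagonal g * Uᴴ) =
      U * diagonal (fun k => f k * g k) * Uᴴ := by
    intro f g
    rw [← diagonal_mul_diagonal, show U * diagonal f * Uᴴ * (U * diagonal g * Uᴴ) =
      U * diagonal f * (Uᴴ * U) * diagonal g * Uᴴ by simp only [Matrix.mul_assoc], h1,
      Matrix.mul_one, Matrix.mul_assoc U]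
  refine ⟨fun i => y i * W, ?_, ?_⟩
  · rw [ColContractive, sum_conjTranspose_mul_unitary, hA, hWs, hW, hmul, hmul]
    have : (1 : Matrix (Fin n) (Fin n) ℂ) = U * diagonal (fun _ => (1 : ℂ)) * Uᴴ := by
      rw [diagonal_one, Matrix.mul_one, h2]
    rw [this, ← Matrix.sub_mul, ← Matrix.mul_sub, diagonal_sub]
    apply PosSemidef.mul_mul_conjTranspose_same
    apply PosSemidef.diagonal
    intro k
    have : (1 : ℂ) - ((Real.sqrt (l k) : ℂ))⁻¹ * (l k : ℂ) * ((Real.sqrt (l k) : ℂ))⁻¹ =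
        ((1 - (Real.sqrt (l k))⁻¹ * (l k) * (Real.sqrt (l k))⁻¹ : ℝ) : ℂ) := by push_cast; rfl
    simp only [Pi.zero_apply]
    rw [this, Complex.zero_le_real]
    rcases (hl k).eq_or_lt with h0 | h0
    · simp [← h0]
    · have := Real.sqrt_pos.2 h0
      have e := Real.mul_self_sqrt (hl k)
      have : (Real.sqrt (l k))⁻¹ * (l k) * (Real.sqrt (l k))⁻¹ = 1 := by
        field_simp
        rw [sq, e]
      rw [this, sub_self]
  · have : pairing (fun i => y i * W) y = (W * ∑ i, (y i)ᴴ * y i).trace.re := by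
      rw [pairing, Finset.mul_sum, trace_sum]
      congr 1
      refine Finset.sum_congr rfl fun i _ => ?_
      rw [conjTranspose_mul, hWs, Matrix.mul_assoc]
    rw [this, hA, hW, hmul, trSqrt_unitary_diagonal h1 hl]
    have e : (fun k => ((Real.sqrt (l k) : ℂ))⁻¹ * (l k : ℂ)) =
        fun k => ((Real.sqrt (l k) : ℝ) : ℂ) := by
      ext k
      rw [← Complex.ofReal_inv, ← Complex.ofReal_mul, inv_mul_eq_div, Real.div_sqrt]
    rw [e, trace_unitary_diagonal h1, Complex.ofReal_re]

lemma pairing_add_right (b x y : ι → Matrix (Fin n) (Fin n) ℂ) :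
    pairing b (fun i => x i + y i) = pairing b x + pairing b y := by
  simp [pairing, Matrix.mul_add, Finset.sum_add_distrib, trace_add]

/-- By the two preceding duality lemmas the left side is a supremum of linear functionals, hence
subadditive. The trace norm is the case of a single matrix. -/
lemma trSqrt_sum_add_le (x y : ι → Matrix (Fin n) (Fin n) ℂ) :
    trSqrt (∑ i, (x i + y i)ᴴ * (x i + y i)) ≤
      trSqrt (∑ i, (x i)ᴴ * x i) + trSqrt (∑ i, (y i)ᴴ * y i) := by
  obtain ⟨b, hb, h⟩ := exists_colContractive_pairing_eq (fun i => x i + y i)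
  rw [← h, pairing_add_right]
  exact add_le_add (hb.pairing_le x) (hb.pairing_le y)

lemma trSqrt_sum_smul (y : ι → Matrix (Fin n) (Fin n) ℂ) (c : ℂ) :
    trSqrt (∑ i, (c • y i)ᴴ * (c • y i)) = ‖c‖ * trSqrt (∑ i, (y i)ᴴ * y i) := by
  rw [← trSqrt_smul (sum_conjTranspose_mul_self_posSemidef y) (norm_nonneg c), Finset.smul_sum]
  congr 1
  refine Finset.sum_congr rfl fun i _ => ?_
  rw [conjTranspose_smul, smul_mul_smul_comm, Complex.star_def, ← Complex.normSq_eq_conj_mul_self,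
    Complex.normSq_eq_norm_sq]

/-- The trace of the square root is at most the sum of the square roots of the diagonal entries in
any orthonormal basis. -/
lemma trSqrt_le_sum_sqrt {A U : Matrix (Fin n) (Fin n) ℂ} (hA : A.PosSemidef) (h1 : Uᴴ * U = 1)
    (h2 : U * Uᴴ = 1) : trSqrt A ≤ ∑ k, Real.sqrt ((Uᴴ * A * U) k k).re := by
  have hR := nonneg_iff_posSemidef.1 (CFC.sqrt_nonneg A)
  have hRR := CFC.sqrt_mul_sqrt_self A (nonneg_iff_posSemidef.2 hA)
  -- Cauchy–Schwarz between the columns of `U`, which are unit vectors, and those of `A^{1/2} U`;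
  -- the pairing is `Tr A^{1/2}`.
  have h := pairing_le_sum_sqrt (fun _ : Unit => U) (fun _ => CFC.sqrt A * U)
  have e := pairing_mul_unitary (fun _ : Unit => 1) (fun _ => CFC.sqrt A) h2
  simp only [Matrix.one_mul] at e
  rw [e] at h
  simp only [pairing, Finset.univ_unique, Finset.sum_singleton, conjTranspose_one,
    Matrix.one_mul, h1, one_apply_eq, Complex.one_re, Real.sqrt_one, conjTranspose_mul,
    hR.isHermitian.eq] at h
  refine h.trans_eq (Finset.sum_congr rfl fun k _ => ?_)
  rw [one_mul, Matrix.mul_assoc, ← Matrix.mul_assoc (CFC.sqrt A), hRR, ← Matrix.mul_assoc]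

lemma traceNorm_add_le (A B : Matrix (Fin n) (Fin n) ℂ) :
    traceNorm (A + B) ≤ traceNorm A + traceNorm B := by
  simpa [traceNorm] using trSqrt_sum_add_le (fun _ : Unit => A) (fun _ => B)

lemma traceNorm_smul (c : ℂ) (A : Matrix (Fin n) (Fin n) ℂ) :
    traceNorm (c • A) = ‖c‖ * traceNorm A := by
  simpa [traceNorm] using trSqrt_sum_smul (fun _ : Unit => A) c

lemma traceNorm_nonneg (A : Matrix (Fin n) (Fin n) ℂ) : 0 ≤ traceNorm A := trSqrt_nonneg _

lemma traceNorm_zero : traceNorm (0 : Matrix (Fin n) (Fin n) ℂ) = 0 := by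
  simp [traceNorm, trSqrt_zero]

lemma trace_re_le_traceNorm {B : Matrix (Fin n) (Fin n) ℂ} (hB : (1 - Bᴴ * B).PosSemidef)
    (A : Matrix (Fin n) (Fin n) ℂ) : (Bᴴ * A).trace.re ≤ traceNorm A := by
  have hb : ColContractive (fun _ : Unit => B) := by simpa [ColContractive] using hB
  simpa [pairing, traceNorm] using hb.pairing_le (fun _ : Unit => A)

lemma posSemidef_one_sub_mul_conjTranspose {b : Matrix (Fin n) (Fin n) ℂ}
    (hb : (1 - bᴴ * b).PosSemidef) : (1 - b * bᴴ).PosSemidef := by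
  have e : 1 - b * bᴴ = (1 - b * bᴴ)ᴴ * (1 - b * bᴴ) + b * (1 - bᴴ * b) * bᴴ := by
    simp only [conjTranspose_sub, conjTranspose_one, conjTranspose_mul, conjTranspose_conjTranspose]
    noncomm_ring
  rw [e]
  exact (posSemidef_conjTranspose_mul_self _).add (hb.mul_mul_conjTranspose_same b)

/-- If `b` is optimal for `Aᴴ`, then its adjoint is also a contraction and pairs with `A` to the
same real value. -/
lemma traceNorm_conjTranspose_le (A : Matrix (Fin n) (Fin n) ℂ) :
    traceNorm Aᴴ ≤ traceNorm A := by
  obtain ⟨b, hb, h⟩ := exists_colContractive_pairing_eq (fun _ : Unit => Aᴴ)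
  simp only [ColContractive, Finset.univ_unique, Finset.sum_singleton, pairing] at hb h
  have hb' : (1 - (b default)ᴴᴴ * (b default)ᴴ).PosSemidef := by
    rw [conjTranspose_conjTranspose]
    exact posSemidef_one_sub_mul_conjTranspose hb
  rw [traceNorm, ← h]
  refine le_of_eq_of_le ?_ (trace_re_le_traceNorm hb' A)
  rw [conjTranspose_conjTranspose, ← conjTranspose_mul, trace_conjTranspose, Matrix.trace_mul_comm]
  simp

lemma traceNorm_conjTranspose (A : Matrix (Fin n) (Fin n) ℂ) : traceNorm Aᴴ = traceNorm A :=
  le_antisymm (traceNorm_conjTranspose_le A) (by simpa using traceNorm_conjTranspose_le Aᴴ)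

end TraceSqrt
end NCKhintchine
end

noncomputable section
namespace NCKhintchine

open Matrix
open scoped MatrixOrder ComplexOrder

/-! ### Column contractivity tested on vectors. -/

section Vectors

variable {n : ℕ} {ι : Type*} [Fintype ι]

/-- The squared Euclidean length of a complex vector. -/
def normSqVec (v : Fin n → ℂ) : ℝ := ∑ k, ‖v k‖ ^ 2

lemma star_dotProduct_self (v : Fin n → ℂ) : star v ⬝ᵥ v = (normSqVec v : ℂ) := by
  simp only [dotProduct, normSqVec, Pi.star_apply, Complex.ofReal_sum]
  refine Finset.sum_congr rfl fun k _ => ?_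
  rw [Complex.star_def, ← Complex.normSq_eq_conj_mul_self, Complex.normSq_eq_norm_sq]

lemma normSqVec_nonneg (v : Fin n → ℂ) : 0 ≤ normSqVec v :=
  Finset.sum_nonneg fun _ _ => sq_nonneg _

lemma normSqVec_pos {v : Fin n → ℂ} (hv : v ≠ 0) : 0 < normSqVec v := by
  obtain ⟨k, hk⟩ := Function.ne_iff.1 hv
  exact Finset.sum_pos' (fun _ _ => sq_nonneg _) ⟨k, Finset.mem_univ _, by
    have : 0 < ‖v k‖ := norm_pos_iff.2 hk
    positivity⟩

lemma star_dotProduct_conjTranspose_mul_mulVec (C : Matrix (Fin n) (Fin n) ℂ) (u : Fin n → ℂ) :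
    star u ⬝ᵥ ((Cᴴ * C) *ᵥ u) = (normSqVec (C *ᵥ u) : ℂ) := by
  rw [← star_dotProduct_self, star_mulVec, ← mulVec_mulVec, dotProduct_mulVec]

lemma star_dotProduct_sum_mulVec (b : ι → Matrix (Fin n) (Fin n) ℂ) (u : Fin n → ℂ) :
    star u ⬝ᵥ ((∑ i, (b i)ᴴ * b i) *ᵥ u) = ((∑ i, normSqVec (b i *ᵥ u) : ℝ) : ℂ) := by
  rw [sum_mulVec, dotProduct_sum, Complex.ofReal_sum]
  exact Finset.sum_congr rfl fun i _ => star_dotProduct_conjTranspose_mul_mulVec _ _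

lemma colContractive_iff (b : ι → Matrix (Fin n) (Fin n) ℂ) :
    ColContractive b ↔ ∀ u, ∑ i, normSqVec (b i *ᵥ u) ≤ normSqVec u := by
  have key : ∀ u, star u ⬝ᵥ ((1 - ∑ i, (b i)ᴴ * b i) *ᵥ u) =
      ((normSqVec u - ∑ i, normSqVec (b i *ᵥ u) : ℝ) : ℂ) := by
    intro u
    rw [sub_mulVec, one_mulVec, dotProduct_sub, star_dotProduct_self, star_dotProduct_sum_mulVec]
    push_cast
    rfl
  rw [ColContractive, posSemidef_iff_dotProduct_mulVec]
  constructor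
  · rintro ⟨-, h⟩ u
    have := h u
    rw [key, Complex.zero_le_real] at this
    linarith
  · intro h
    refine ⟨?_, fun u => ?_⟩
    · exact isHermitian_one.sub (sum_conjTranspose_mul_self_posSemidef b).isHermitian
    · rw [key, Complex.zero_le_real]
      linarith [h u]

end Vectors

/-! ### Duality between the dual norm and bicontractive families. -/

section DualNorm

variable {n d : ℕ}

/-- A family of matrices that is contractive both as a column and as a row. -/
def BiContractive (b : Fin d → Matrix (Fin n) (Fin n) ℂ) : Prop :=
  ColContractive b ∧ ColContractive fun i => (b i)ᴴ

lemma pairing_conjTranspose {ι : Type*} [Fintype ι] (b x : ι → Matrix (Fin n) (Fin n) ℂ) :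
    pairing (fun i => (b i)ᴴ) (fun i => (x i)ᴴ) = pairing b x := by
  simp only [pairing, Complex.re_sum]
  refine Finset.sum_congr rfl fun i _ => ?_
  rw [← conjTranspose_mul, trace_conjTranspose, Matrix.trace_mul_comm]
  simp

lemma bddBelow_dualNorm_set (x : Fin d → Matrix (Fin n) (Fin n) ℂ) :
    BddBelow {t : ℝ | ∃ y z : Fin d → Matrix (Fin n) (Fin n) ℂ, (∀ i, x i = y i + z i) ∧
      t = trSqrt (∑ i, (y i)ᴴ * y i) + trSqrt (∑ i, z i * (z i)ᴴ)} := by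
  refine ⟨0, ?_⟩
  rintro t ⟨y, z, -, rfl⟩
  exact add_nonneg (trSqrt_nonneg _) (trSqrt_nonneg _)

lemma dualNorm_add_le_trSqrt (y z : Fin d → Matrix (Fin n) (Fin n) ℂ) :
    dualNorm (fun i => y i + z i) ≤
      trSqrt (∑ i, (y i)ᴴ * y i) + trSqrt (∑ i, z i * (z i)ᴴ) :=
  csInf_le (bddBelow_dualNorm_set _) ⟨y, z, fun _ => rfl, rfl⟩

lemma le_dualNorm {x : Fin d → Matrix (Fin n) (Fin n) ℂ} {c : ℝ}
    (h : ∀ y z : Fin d → Matrix (Fin n) (Fin n) ℂ, x = (fun i => y i + z i) →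
      c ≤ trSqrt (∑ i, (y i)ᴴ * y i) + trSqrt (∑ i, z i * (z i)ᴴ)) : c ≤ dualNorm x := by
  refine le_csInf ⟨_, x, 0, by simp, rfl⟩ ?_
  rintro t ⟨y, z, hx, rfl⟩
  exact h y z (funext hx)

lemma dualNorm_nonneg (x : Fin d → Matrix (Fin n) (Fin n) ℂ) : 0 ≤ dualNorm x :=
  le_dualNorm fun _ _ _ => add_nonneg (trSqrt_nonneg _) (trSqrt_nonneg _)

lemma dualNorm_le_trSqrt_col (x : Fin d → Matrix (Fin n) (Fin n) ℂ) :
    dualNorm x ≤ trSqrt (∑ i, (x i)ᴴ * x i) := by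
  simpa [trSqrt_zero] using dualNorm_add_le_trSqrt x 0

lemma dualNorm_le_trSqrt_row (x : Fin d → Matrix (Fin n) (Fin n) ℂ) :
    dualNorm x ≤ trSqrt (∑ i, x i * (x i)ᴴ) := by
  simpa [trSqrt_zero] using dualNorm_add_le_trSqrt 0 x

/-- For each decomposition, the column condition controls the pairing with `y` and the row condition
the pairing with `z`. -/
lemma BiContractive.pairing_le {b : Fin d → Matrix (Fin n) (Fin n) ℂ} (hb : BiContractive b)
    (x : Fin d → Matrix (Fin n) (Fin n) ℂ) : pairing b x ≤ dualNorm x := by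
  refine le_dualNorm ?_
  rintro y z rfl
  rw [pairing_add_right, ← pairing_conjTranspose b z]
  refine add_le_add (hb.1.pairing_le y) ?_
  simpa using hb.2.pairing_le fun i => (z i)ᴴ

lemma dualNorm_add_le (x x' : Fin d → Matrix (Fin n) (Fin n) ℂ) :
    dualNorm (x + x') ≤ dualNorm x + dualNorm x' := by
  rw [← sub_le_iff_le_add]
  refine le_dualNorm fun y z hx => ?_
  rw [sub_le_comm]
  refine le_dualNorm fun y' z' hx' => ?_
  rw [sub_le_iff_le_add]
  have e : x + x' = fun i => (y i + y' i) + (z i + z' i) := by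
    ext1 i
    rw [hx, hx', Pi.add_apply, add_add_add_comm]
  have h1 := trSqrt_sum_add_le y y'
  have h2 := trSqrt_sum_add_le (fun i => (z i)ᴴ) fun i => (z' i)ᴴ
  simp only [← conjTranspose_add, conjTranspose_conjTranspose] at h2
  have h3 := dualNorm_add_le_trSqrt (fun i => y i + y' i) fun i => z i + z' i
  rw [e]
  linarith

lemma dualNorm_smul_le (x : Fin d → Matrix (Fin n) (Fin n) ℂ) {c : ℝ} (hc : 0 < c) :
    dualNorm (c • x) ≤ c * dualNorm x := by
  rw [← div_le_iff₀' hc]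
  refine le_dualNorm fun y z hx => ?_
  rw [div_le_iff₀' hc]
  have e : c • x = fun i => (c : ℂ) • y i + (c : ℂ) • z i := by
    ext1 i
    rw [hx, ← smul_add, Pi.smul_apply, Complex.coe_smul]
  have h1 := trSqrt_sum_smul y c
  have h2 := trSqrt_sum_smul (fun i => (z i)ᴴ) c
  have h3 := dualNorm_add_le_trSqrt (fun i => (c : ℂ) • y i) fun i => (c : ℂ) • z i
  simp only [conjTranspose_smul, conjTranspose_conjTranspose, Complex.norm_real, Complex.star_def,
    Complex.conj_ofReal, Real.norm_of_nonneg hc.le] at h1 h2 h3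
  rw [e]
  linarith

lemma dualNorm_smul (x : Fin d → Matrix (Fin n) (Fin n) ℂ) {c : ℝ} (hc : 0 < c) :
    dualNorm (c • x) = c * dualNorm x := by
  refine le_antisymm (dualNorm_smul_le x hc) ?_
  have := dualNorm_smul_le (c • x) (inv_pos.2 hc)
  rwa [smul_smul, inv_mul_cancel₀ hc.ne', one_smul, le_inv_mul_iff₀ hc] at this

/-- Every real-linear functional on families of matrices is a real trace pairing. -/
lemma exists_pairing_eq (g : (Fin d → Matrix (Fin n) (Fin n) ℂ) →ₗ[ℝ] ℝ) :
    ∃ b, ∀ y, g y = pairing b y := by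
  -- The real and imaginary parts of the entry record `g` on `E_jk` and `i E_jk`, because `Re (conj
  -- β c) = Re β Re c + Im β Im c`.
  refine ⟨fun i => Matrix.of fun j k => (g (Pi.single i (Matrix.single j k 1)) : ℂ) +
    (g (Pi.single i (Matrix.single j k Complex.I)) : ℂ) * Complex.I, fun y => ?_⟩
  have hc : ∀ i j k (c : ℂ), g (Pi.single i (Matrix.single j k c)) =
      c.re * g (Pi.single i (Matrix.single j k 1)) +
        c.im * g (Pi.single i (Matrix.single j k Complex.I)) := by
    intro i j k c
    have : (Pi.single i (Matrix.single j k c) : Fin d → Matrix (Fin n) (Fin n) ℂ) =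
        c.re • (Pi.single i (Matrix.single j k 1) : Fin d → Matrix (Fin n) (Fin n) ℂ) +
          c.im • (Pi.single i (Matrix.single j k Complex.I) :
            Fin d → Matrix (Fin n) (Fin n) ℂ) := by
      rw [← Pi.single_smul, ← Pi.single_smul, ← Pi.single_add, Matrix.smul_single,
        Matrix.smul_single, ← Matrix.single_add]
      congr 2
      apply Complex.ext <;> simp
    rw [this, map_add, map_smul, map_smul, smul_eq_mul, smul_eq_mul]
  have hy : y = ∑ i, ∑ j, ∑ k, Pi.single i (Matrix.single j k (y i j k)) := by
    conv_lhs => rw [← Finset.univ_sum_single y]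
    refine Finset.sum_congr rfl fun i _ => ?_
    conv_lhs => rw [matrix_eq_sum_single (y i)]
    have : ∀ A : Matrix (Fin n) (Fin n) ℂ, (Pi.single i A : Fin d → Matrix (Fin n) (Fin n) ℂ) =
      AddMonoidHom.single (fun _ : Fin d => Matrix (Fin n) (Fin n) ℂ) i A := fun _ => rfl
    simp only [this, map_sum]
  conv_lhs => rw [hy]
  simp only [map_sum, pairing, trace_conjTranspose_mul, Complex.re_sum]
  refine Finset.sum_congr rfl fun i _ => ?_
  rw [Finset.sum_comm]
  refine Finset.sum_congr rfl fun k _ => Finset.sum_congr rfl fun j _ => ?_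
  rw [hc]
  simp
  ring

/-- Testing on `y_i = b_i u u*` collapses the inequality to `β ≤ √(β ν)`, where `β = ∑ ‖b_i u‖²` and
`ν = ‖u‖²`; this is `β ≤ ν`. -/
lemma colContractive_of_pairing_le {b : Fin d → Matrix (Fin n) (Fin n) ℂ}
    (h : ∀ y : Fin d → Matrix (Fin n) (Fin n) ℂ, pairing b y ≤ trSqrt (∑ i, (y i)ᴴ * y i)) :
    ColContractive b := by
  rw [colContractive_iff]
  intro u
  set β := ∑ i, normSqVec (b i *ᵥ u) with hβ
  set ν := normSqVec u with hν
  rcases le_or_gt β 0 with h0 | h0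
  · exact h0.trans (normSqVec_nonneg u)
  have hν0 : 0 < ν := by
    apply normSqVec_pos
    rintro rfl
    simp [hβ, normSqVec] at h0
  set Q : Matrix (Fin n) (Fin n) ℂ := vecMulVec u (star u) with hQ
  have hQs : Qᴴ = Q := by simp [hQ, conjTranspose_vecMulVec]
  have hBQ : ∀ B : Matrix (Fin n) (Fin n) ℂ, Q * B * Q = (star u ⬝ᵥ (B *ᵥ u)) • Q := by
    intro B
    rw [Matrix.mul_assoc, hQ, mul_vecMulVec, vecMulVec_mul_vecMulVec, vecMulVec_smul]
  have hQQ : Q * Q = (ν : ℂ) • Q := by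
    have := hBQ 1
    rwa [Matrix.mul_one, one_mulVec, star_dotProduct_self] at this
  have htr : Q.trace = (ν : ℂ) := by
    rw [hQ, trace_vecMulVec, dotProduct_comm, star_dotProduct_self]
  have hsum : ∑ i, (b i * Q)ᴴ * (b i * Q) = (β : ℂ) • Q := by
    rw [sum_conjTranspose_mul_unitary, hQs, hBQ, star_dotProduct_sum_mulVec]
  have hpair : pairing b (fun i => b i * Q) = β := by
    simp only [pairing, ← Matrix.mul_assoc]
    rw [← trace_sum, ← Finset.sum_mul, hQ, mul_vecMulVec, trace_vecMulVec, dotProduct_comm,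
      star_dotProduct_sum_mulVec, Complex.ofReal_re]
  have hβν : 0 < β * ν := mul_pos h0 hν0
  have hs := Real.sqrt_pos.2 hβν
  have htrs : trSqrt ((β : ℂ) • Q) = Real.sqrt (β * ν) := by
    rw [trSqrt_of_mul_self (hsum ▸ sum_conjTranspose_mul_self_posSemidef _) hs, trace_smul, htr,
      smul_eq_mul, ← Complex.ofReal_mul, Complex.ofReal_re, Real.div_sqrt]
    rw [smul_mul_smul_comm, hQQ, smul_smul, smul_smul, Real.sq_sqrt hβν.le]
    congr 1
    push_cast
    ring
  have := h fun i => b i * Q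
  rw [hpair, hsum, htrs, Real.le_sqrt' h0] at this
  rw [sq] at this
  exact le_of_mul_le_mul_left this h0

/-- The dual norm is attained by a pairing with a bicontractive family. -/
lemma exists_biContractive_pairing_eq (x : Fin d → Matrix (Fin n) (Fin n) ℂ) :
    ∃ b, BiContractive b ∧ pairing b x = dualNorm x := by
  -- Hahn–Banach with the sublinear function `dualNorm`, extending from the real line through `x`;
  -- the zero vector spans no line and is treated apart.
  have hext : ∃ g : (Fin d → Matrix (Fin n) (Fin n) ℂ) →ₗ[ℝ] ℝ, g x = dualNorm x ∧
      ∀ y, g y ≤ dualNorm y := by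
    by_cases hx : x = 0
    · refine ⟨0, ?_, fun y => dualNorm_nonneg y⟩
      refine le_antisymm (dualNorm_nonneg x) ?_
      simpa [hx, trSqrt_zero] using dualNorm_le_trSqrt_col x
    · obtain ⟨g, hg, hle⟩ := exists_extension_of_le_sublinear
        (LinearPMap.mkSpanSingleton x (dualNorm x) hx) dualNorm
        (fun c hc y => dualNorm_smul y hc) dualNorm_add_le (by
          rintro ⟨y, hy⟩
          obtain ⟨c, rfl⟩ := Submodule.mem_span_singleton.1 hy
          rw [show LinearPMap.mkSpanSingleton x (dualNorm x) hx ⟨c • x, hy⟩ = c • dualNorm x from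
            LinearPMap.mkSpanSingleton'_apply _ _ _ _ _]
          rcases lt_or_ge 0 c with hc | hc
          · exact (dualNorm_smul x hc).ge
          · exact (mul_nonpos_of_nonpos_of_nonneg hc (dualNorm_nonneg x)).trans
              (dualNorm_nonneg _))
      refine ⟨g, ?_, hle⟩
      have := hg ⟨x, Submodule.mem_span_singleton_self x⟩
      rw [this]
      exact LinearPMap.mkSpanSingleton_apply ℝ _ hx (dualNorm x)
  obtain ⟨g, hgx, hg⟩ := hext
  obtain ⟨b, hb⟩ := exists_pairing_eq g
  refine ⟨b, ⟨?_, ?_⟩, by rw [← hb, hgx]⟩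
  · exact colContractive_of_pairing_le fun y => (hb y ▸ hg y).trans (dualNorm_le_trSqrt_col y)
  · refine colContractive_of_pairing_le fun y => ?_
    have h := (hg fun i => (y i)ᴴ).trans (dualNorm_le_trSqrt_row _)
    rw [hb, ← pairing_conjTranspose] at h
    simpa using h

end DualNorm
end NCKhintchine
end

noncomputable section
namespace NCKhintchine

open scoped ComplexConjugate

/-! ### Gaussian moments up to order four. -/

section Moments

lemma gaussian_norm_pow_integrable_and_integral (k : ℕ) :
    Integrable (fun z : ℂ => (Real.pi⁻¹ * Real.exp (-‖z‖ ^ 2)) * ‖z‖ ^ k) ∧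
    ∫ z : ℂ, (Real.pi⁻¹ * Real.exp (-‖z‖ ^ 2)) * ‖z‖ ^ k = Real.Gamma (((k : ℝ) + 2) / 2) := by
  have h := Complex.integral_rpow_mul_exp_neg_mul_rpow (p := 2) (q := k) (b := 1) one_le_two
    (by linarith [(Nat.cast_nonneg k : (0 : ℝ) ≤ k)]) one_pos
  have e : (fun z : ℂ => (Real.pi⁻¹ * Real.exp (-‖z‖ ^ 2)) * ‖z‖ ^ k) =
      fun z : ℂ => Real.pi⁻¹ * (‖z‖ ^ (k : ℝ) * Real.exp (-1 * ‖z‖ ^ (2 : ℝ))) := by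
    ext z
    rw [Real.rpow_natCast, Real.rpow_two]
    ring_nf
  have h2 : ∫ z : ℂ, (Real.pi⁻¹ * Real.exp (-‖z‖ ^ 2)) * ‖z‖ ^ k =
      Real.Gamma (((k : ℝ) + 2) / 2) := by
    rw [e, integral_const_mul, h, Real.one_rpow]
    field_simp
  refine ⟨?_, h2⟩
  -- The integral of a non-integrable function is `0` by convention, while the value just found is
  -- positive.
  by_contra hn
  rw [integral_undef hn] at h2
  exact (Real.Gamma_pos_of_pos (s := ((k : ℝ) + 2) / 2) (by positivity)).ne h2

lemma integral_stdComplexGaussian {E : Type*} [NormedAddCommGroup E] [NormedSpace ℝ E]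
    (f : ℂ → E) : ∫ z, f z ∂stdComplexGaussian =
      ∫ z : ℂ, (Real.pi⁻¹ * Real.exp (-‖z‖ ^ 2)) • f z := by
  rw [stdComplexGaussian, integral_withDensity_eq_integral_toReal_smul (by fun_prop)
    (Filter.Eventually.of_forall fun _ => ENNReal.ofReal_lt_top)]
  refine integral_congr_ae (Filter.Eventually.of_forall fun z => ?_)
  dsimp only
  rw [ENNReal.toReal_ofReal (by positivity)]

lemma integrable_norm_pow_stdComplexGaussian (k : ℕ) :
    Integrable (fun z : ℂ => ‖z‖ ^ k) stdComplexGaussian := by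
  rw [stdComplexGaussian, integrable_withDensity_iff_integrable_smul' (by fun_prop)
    (Filter.Eventually.of_forall fun _ => ENNReal.ofReal_lt_top)]
  refine (gaussian_norm_pow_integrable_and_integral k).1.congr
    (Filter.Eventually.of_forall fun z => ?_)
  dsimp only
  rw [ENNReal.toReal_ofReal (by positivity), smul_eq_mul]

lemma integral_pow_mul_conj_pow_self (p : ℕ) :
    ∫ z, z ^ p * conj z ^ p ∂stdComplexGaussian = (p.factorial : ℂ) := by
  have e : ∀ z : ℂ, z ^ p * conj z ^ p = ((‖z‖ ^ (2 * p) : ℝ) : ℂ) := by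
    intro z
    rw [← mul_pow, Complex.mul_conj, Complex.normSq_eq_norm_sq, pow_mul]
    push_cast
    rfl
  simp_rw [e]
  rw [integral_complex_ofReal, integral_stdComplexGaussian]
  simp only [smul_eq_mul]
  rw [(gaussian_norm_pow_integrable_and_integral (2 * p)).2]
  have : ((2 * p : ℕ) + 2 : ℝ) / 2 = p + 1 := by push_cast; ring
  rw [this, Real.Gamma_nat_eq_factorial]
  simp

/-- The law is invariant under multiplication by `i`, which multiplies the integral by `i^(p-q)`.
This factor differs from `1` because `0 < |p - q| ≤ 2`. -/
lemma integral_pow_mul_conj_pow_of_ne {p q : ℕ} (hp : p ≤ 2) (hq : q ≤ 2) (hpq : p ≠ q) :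
    ∫ z, z ^ p * conj z ^ q ∂stdComplexGaussian = 0 := by
  set m := ∫ z, z ^ p * conj z ^ q ∂stdComplexGaussian with hm
  have h : m = (Complex.I ^ p * conj Complex.I ^ q) * m := by
    rw [hm, integral_stdComplexGaussian, ← integral_const_mul]
    have hmp := (rotation ⟨Complex.I, mem_sphere_zero_iff_norm.2 Complex.norm_I⟩).measurePreserving
    rw [← hmp.integral_comp (rotation ⟨Complex.I, mem_sphere_zero_iff_norm.2 Complex.norm_I⟩).toHomeomorph.measurableEmbedding]
    refine integral_congr_ae (Filter.Eventually.of_forall fun z => ?_)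
    have hr : rotation ⟨Complex.I, mem_sphere_zero_iff_norm.2 Complex.norm_I⟩ z =
      Complex.I * z := rfl
    simp only [hr, norm_mul, Complex.norm_I, one_mul, mul_pow, map_mul,
      Complex.real_smul]
    ring
  have hc : Complex.I ^ p * conj Complex.I ^ q ≠ 1 := by
    intro hc
    have h1 : (-1 : ℂ) ≠ 1 := by norm_num
    interval_cases p <;> interval_cases q <;>
      simp [Complex.ext_iff, pow_two] at hc hpq <;> norm_num at hc
  have : (1 - Complex.I ^ p * conj Complex.I ^ q) * m = 0 := by
    rw [sub_mul, one_mul, ← h, sub_self]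
  exact (mul_eq_zero.1 this).resolve_left (sub_ne_zero.2 hc.symm)

lemma map_conj_stdComplexGaussian :
    stdComplexGaussian.map (starRingEnd ℂ) = stdComplexGaussian := by
  have hc : Measurable (starRingEnd ℂ) := Complex.continuous_conj.measurable
  have hmp : MeasurePreserving (starRingEnd ℂ) (volume : Measure ℂ) volume :=
    Complex.conjLIE.measurePreserving
  ext s hs
  rw [Measure.map_apply hc hs, stdComplexGaussian, withDensity_apply _ (hc hs),
    withDensity_apply _ hs, ← hmp.setLIntegral_comp_preimage hs (by fun_prop)]
  simp only [RCLike.norm_conj]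

variable {Ω : Type*} [MeasurableSpace Ω] {P : Measure Ω} {d : ℕ} {γ : Fin d → Ω → ℂ}

namespace IsIndepStdComplexGaussian

lemma aemeasurable (hγ : IsIndepStdComplexGaussian γ P) (i : Fin d) : AEMeasurable (γ i) P :=
  (hγ.hasLaw i).aemeasurable

/-- Since `(∑ γ_i x_i)*` is a Gaussian sum with conjugated variables, this turns every column
estimate into a row estimate. -/
lemma conjugate (hγ : IsIndepStdComplexGaussian γ P) :
    IsIndepStdComplexGaussian (fun i ω => conj (γ i ω)) P := by
  have hc : Measurable (starRingEnd ℂ) := Complex.continuous_conj.measurable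
  refine ⟨fun i => ⟨hc.comp_aemeasurable (hγ.aemeasurable i), ?_⟩,
    hγ.indep.comp (fun _ => starRingEnd ℂ) fun _ => hc⟩
  have h := AEMeasurable.map_map_of_aemeasurable hc.aemeasurable (hγ.aemeasurable i)
  rw [(hγ.hasLaw i).map_eq, map_conj_stdComplexGaussian] at h
  exact h.symm

lemma integrable_norm_pow (hγ : IsIndepStdComplexGaussian γ P) (i : Fin d) (k : ℕ) :
    Integrable (fun ω => ‖γ i ω‖ ^ k) P := by
  have h := integrable_norm_pow_stdComplexGaussian k
  rw [← (hγ.hasLaw i).map_eq] at h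
  exact h.comp_aemeasurable (hγ.aemeasurable i)

lemma memLp_two (hγ : IsIndepStdComplexGaussian γ P) (i : Fin d) : MemLp (γ i) 2 P :=
  (memLp_two_iff_integrable_sq_norm (hγ.aemeasurable i).aestronglyMeasurable).2
    (hγ.integrable_norm_pow i 2)

lemma integral_prod_pow (hγ : IsIndepStdComplexGaussian γ P) {p q : Fin d → ℕ}
    (hp : ∀ m, p m ≤ 2) (hq : ∀ m, q m ≤ 2) :
    ∫ ω, ∏ m, (γ m ω ^ p m * conj (γ m ω) ^ q m) ∂P =
      ∏ m, if p m = q m then ((p m).factorial : ℂ) else 0 := by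
  have h := hγ.indep.integral_fun_prod_comp (𝕜 := ℂ)
    (f := fun m z => z ^ p m * conj z ^ q m) hγ.aemeasurable
    (fun m => by
      apply Continuous.aestronglyMeasurable
      fun_prop)
  rw [h]
  refine Finset.prod_congr rfl fun m _ => ?_
  have h2 := (hγ.hasLaw m).integral_comp (f := fun z => z ^ p m * conj z ^ q m)
    (by apply Continuous.aestronglyMeasurable; fun_prop)
  simp only [Function.comp_def] at h2
  rw [h2]
  split_ifs with hpq
  · rw [← hpq, integral_pow_mul_conj_pow_self]
  · exact integral_pow_mul_conj_pow_of_ne (hp m) (hq m) hpq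

lemma integral_conj_mul (hγ : IsIndepStdComplexGaussian γ P) (i j : Fin d) :
    ∫ ω, conj (γ i ω) * γ j ω ∂P = if i = j then 1 else 0 := by
  have h := hγ.integral_prod_pow (p := fun m => if m = j then 1 else 0)
    (q := fun m => if m = i then 1 else 0) (fun m => by split_ifs <;> norm_num)
    (fun m => by split_ifs <;> norm_num)
  simp only [Finset.prod_mul_distrib, pow_ite, pow_one, pow_zero, Finset.prod_ite_eq',
    Finset.mem_univ, if_true] at h
  simp only [mul_comm (conj _)]
  rw [h]
  split_ifs with hij
  · subst hij
    refine Finset.prod_eq_one fun m _ => ?_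
    rw [if_pos rfl]
    split_ifs <;> simp
  · refine Finset.prod_eq_zero (Finset.mem_univ i) ?_
    simp [hij]

/-- Wick's formula: by independence only the matchings of the conjugated indices `i, k` with the
unconjugated `j, l` survive. When all four agree, both terms occur and give `2! = 2`. -/
lemma integral_conj_mul_mul_conj_mul (hγ : IsIndepStdComplexGaussian γ P) (i j k l : Fin d) :
    ∫ ω, conj (γ i ω) * γ j ω * (conj (γ k ω) * γ l ω) ∂P =
      (if i = j ∧ k = l then 1 else 0) + (if i = l ∧ j = k then 1 else 0) := by
  have h := hγ.integral_prod_pow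
    (p := fun m => (if m = j then 1 else 0) + (if m = l then 1 else 0))
    (q := fun m => (if m = i then 1 else 0) + (if m = k then 1 else 0))
    (fun m => by split_ifs <;> norm_num)
    (fun m => by split_ifs <;> norm_num)
  simp only [pow_add, Finset.prod_mul_distrib, pow_ite, pow_one, pow_zero, Finset.prod_ite_eq',
    Finset.mem_univ, if_true] at h
  have e : ∀ ω, conj (γ i ω) * γ j ω * (conj (γ k ω) * γ l ω) =
      γ j ω * γ l ω * (conj (γ i ω) * conj (γ k ω)) := fun ω => by ring
  simp_rw [e]
  rw [h]
  have hone : ∀ a b : Fin d, a ≠ b → ∏ m, (if (if m = a then 1 else 0) + (if m = b then 1 else 0) =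
      (if m = a then 1 else 0) + (if m = b then 1 else 0) then
        ((((if m = a then 1 else 0) + (if m = b then 1 else 0) : ℕ)).factorial : ℂ) else 0) = 1 := by
    intro a b hab
    refine Finset.prod_eq_one fun m _ => ?_
    rw [if_pos rfl]
    by_cases ha : m = a
    · have : m ≠ b := fun hb => hab (ha ▸ hb)
      simp [ha, hab]
    · by_cases hb : m = b <;> simp [ha, hb, hab.symm]
  by_cases h1 : i = j ∧ k = l
  · obtain ⟨rfl, rfl⟩ := h1
    by_cases hik : i = k
    · subst hik
      rw [Finset.prod_eq_single i]
      · norm_num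
      · intro m _ hm
        simp [hm]
      · simp
    · rw [hone i k hik]
      simp [hik]
  · by_cases h2 : i = l ∧ j = k
    · obtain ⟨rfl, rfl⟩ := h2
      have hij : i ≠ j := fun h => h1 ⟨h, h.symm⟩
      have := hone j i hij.symm
      rw [if_neg h1, if_pos ⟨rfl, rfl⟩, zero_add, ← this]
      refine Finset.prod_congr rfl fun m _ => ?_
      simp [add_comm]
    · rw [if_neg h1, if_neg h2, add_zero]
      by_cases hij : i = j
      · have hkl : k ≠ l := fun h => h1 ⟨hij, h⟩
        refine Finset.prod_eq_zero (Finset.mem_univ k) ?_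
        rw [if_neg]
        subst hij
        simp [hkl]
      · by_cases hil : i = l
        · have hjk : k ≠ j := fun h => h2 ⟨hil, h.symm⟩
          refine Finset.prod_eq_zero (Finset.mem_univ k) ?_
          rw [if_neg]
          subst hil
          simp [hjk]
        · refine Finset.prod_eq_zero (Finset.mem_univ i) ?_
          rw [if_neg]
          simp only [hij, hil, if_false, if_true]
          omega

lemma integrable_conj_mul (hγ : IsIndepStdComplexGaussian γ P) (i j : Fin d) :
    Integrable (fun ω => conj (γ i ω) * γ j ω) P :=
  (hγ.memLp_two i).star.integrable_mul (hγ.memLp_two j)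

lemma integrable_conj_mul_mul_conj_mul (hγ : IsIndepStdComplexGaussian γ P) (i j k l : Fin d) :
    Integrable (fun ω => conj (γ i ω) * γ j ω * (conj (γ k ω) * γ l ω)) P := by
  have hm := hγ.aemeasurable
  refine Integrable.mono' (((hγ.integrable_norm_pow i 4).add (hγ.integrable_norm_pow j 4)).add
    ((hγ.integrable_norm_pow k 4).add (hγ.integrable_norm_pow l 4))) ?_
    (Filter.Eventually.of_forall fun ω => ?_)
  · have h1 := hm i
    have h2 := hm j
    have h3 := hm k
    have h4 := hm l
    have hc : Measurable (starRingEnd ℂ) := Complex.continuous_conj.measurable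
    exact (((hc.comp_aemeasurable h1).mul h2).mul ((hc.comp_aemeasurable h3).mul h4)).aestronglyMeasurable
  · simp only [norm_mul, RCLike.norm_conj, Pi.add_apply]
    generalize ‖γ i ω‖ = a
    generalize ‖γ j ω‖ = b
    generalize ‖γ k ω‖ = c
    generalize ‖γ l ω‖ = e
    nlinarith [sq_nonneg (a * b - c * e), sq_nonneg (a ^ 2 - b ^ 2), sq_nonneg (c ^ 2 - e ^ 2),
      sq_nonneg (a ^ 2), sq_nonneg (b ^ 2), sq_nonneg (c ^ 2), sq_nonneg (e ^ 2)]

end IsIndepStdComplexGaussian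

end Moments
end NCKhintchine
end

noncomputable section
namespace NCKhintchine

open Matrix
open scoped MatrixOrder ComplexOrder ComplexConjugate

/-! ### Matrix moments and the upper Khintchine bound. -/

section UpperBound

variable {n d : ℕ}

lemma traceNorm_sum_le {ι : Type*} [Fintype ι] (f : ι → Matrix (Fin n) (Fin n) ℂ) :
    traceNorm (∑ i, f i) ≤ ∑ i, traceNorm (f i) :=
  Finset.le_sum_of_subadditive _ traceNorm_zero.le traceNorm_add_le _ _

lemma traceNorm_sum_smul_le (x : Fin d → Matrix (Fin n) (Fin n) ℂ) (c : Fin d → ℂ) :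
    traceNorm (∑ i, c i • x i) ≤ ∑ i, ‖c i‖ * traceNorm (x i) :=
  (traceNorm_sum_le _).trans_eq (Finset.sum_congr rfl fun _ _ => traceNorm_smul _ _)

/-- Lipschitz dependence on the coefficients; it serves to make the random trace norm measurable. -/
lemma continuous_traceNorm_sum_smul (x : Fin d → Matrix (Fin n) (Fin n) ℂ) :
    Continuous fun c : Fin d → ℂ => traceNorm (∑ i, c i • x i) := by
  refine (LipschitzWith.of_le_add_mul (∑ i, (traceNorm (x i)).toNNReal)
    fun c c' => ?_).continuous
  have e : ∑ i, c i • x i = ∑ i, c' i • x i + ∑ i, (c i - c' i) • x i := by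
    rw [← Finset.sum_add_distrib]
    refine Finset.sum_congr rfl fun i _ => ?_
    rw [← add_smul, add_sub_cancel]
  rw [e]
  refine (traceNorm_add_le _ _).trans (add_le_add_right ((traceNorm_sum_smul_le x _).trans ?_) _)
  rw [NNReal.coe_sum, Finset.sum_mul]
  refine Finset.sum_le_sum fun i _ => ?_
  rw [Real.coe_toNNReal _ (traceNorm_nonneg _), mul_comm]
  refine mul_le_mul_of_nonneg_left ?_ (traceNorm_nonneg _)
  rw [← dist_eq_norm]
  exact dist_le_pi_dist c c' i

/-- The inequality is nonnegativity of the variance of `√f`; integrability comes from `√f ≤ f + 1`.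
-/
lemma integral_sqrt_le {Ω : Type*} [MeasurableSpace Ω] {P : Measure Ω} [IsProbabilityMeasure P]
    {f : Ω → ℝ} (hf : Integrable f P) (h0 : ∀ ω, 0 ≤ f ω) :
    Integrable (fun ω => Real.sqrt (f ω)) P ∧
      ∫ ω, Real.sqrt (f ω) ∂P ≤ Real.sqrt (∫ ω, f ω ∂P) := by
  have hi : Integrable (fun ω => Real.sqrt (f ω)) P := by
    refine Integrable.mono' (hf.add (integrable_const 1))
      (Real.continuous_sqrt.comp_aestronglyMeasurable hf.1)
      (Filter.Eventually.of_forall fun ω => ?_)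
    rw [Real.norm_of_nonneg (Real.sqrt_nonneg _)]
    have := Real.sq_sqrt (h0 ω)
    simp only [Pi.add_apply]
    nlinarith [sq_nonneg (Real.sqrt (f ω) - 1)]
  refine ⟨hi, Real.le_sqrt_of_sq_le ?_⟩
  set m := ∫ ω, Real.sqrt (f ω) ∂P with hm
  have h : 0 ≤ ∫ ω, (Real.sqrt (f ω) - m) ^ 2 ∂P := integral_nonneg fun _ => sq_nonneg _
  have e : ∀ ω, (Real.sqrt (f ω) - m) ^ 2 = f ω - 2 * m * Real.sqrt (f ω) + m ^ 2 := by
    intro ω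
    have := Real.sq_sqrt (h0 ω)
    linear_combination this
  simp_rw [e] at h
  have hi2 : Integrable (fun ω => 2 * m * Real.sqrt (f ω)) P := hi.const_mul _
  have hi3 : Integrable (fun ω => f ω - 2 * m * Real.sqrt (f ω)) P := hf.sub hi2
  rw [integral_add hi3 (integrable_const _), integral_sub hf hi2, integral_const_mul, ← hm, integral_const] at h
  simp only [probReal_univ, one_smul] at h
  linarith

variable {Ω : Type*} [MeasurableSpace Ω] {P : Measure Ω} {γ : Fin d → Ω → ℂ}

namespace IsIndepStdComplexGaussian

lemma aemeasurable_pi (hγ : IsIndepStdComplexGaussian γ P) :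
    AEMeasurable (fun ω i => γ i ω) P :=
  aemeasurable_pi_lambda _ hγ.aemeasurable

lemma integrable_traceNorm_randomSum (hγ : IsIndepStdComplexGaussian γ P)
    (x : Fin d → Matrix (Fin n) (Fin n) ℂ) :
    Integrable (fun ω => traceNorm (randomSum x γ ω)) P := by
  refine Integrable.mono' (g := fun ω => ∑ i, ‖γ i ω‖ * traceNorm (x i)) ?_ ?_
    (Filter.Eventually.of_forall fun ω => ?_)
  · refine integrable_finsetSum _ fun i _ => Integrable.mul_const ?_ _
    simpa using hγ.integrable_norm_pow i 1
  · exact ((continuous_traceNorm_sum_smul x).measurable.comp_aemeasurable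
      hγ.aemeasurable_pi).aestronglyMeasurable
  · rw [Real.norm_of_nonneg (traceNorm_nonneg _)]
    exact traceNorm_sum_smul_le x _

lemma conjTranspose_randomSum_mul_randomSum {Ω : Type*} {γ : Fin d → Ω → ℂ}
    (y z : Fin d → Matrix (Fin n) (Fin n) ℂ) (ω : Ω) :
    (randomSum y γ ω)ᴴ * randomSum z γ ω =
      ∑ i, ∑ j, (conj (γ i ω) * γ j ω) • ((y i)ᴴ * z j) := by
  rw [randomSum, randomSum, conjTranspose_sum, Finset.sum_mul_sum]
  refine Finset.sum_congr rfl fun i _ => Finset.sum_congr rfl fun j _ => ?_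
  rw [conjTranspose_smul, smul_mul_smul_comm, Complex.star_def]

lemma integrable_linear_conjTranspose_mul (hγ : IsIndepStdComplexGaussian γ P)
    (φ : Matrix (Fin n) (Fin n) ℂ →ₗ[ℂ] ℂ) (y z : Fin d → Matrix (Fin n) (Fin n) ℂ) :
    Integrable (fun ω => φ ((randomSum y γ ω)ᴴ * randomSum z γ ω)) P := by
  simp only [conjTranspose_randomSum_mul_randomSum, map_sum, map_smul, smul_eq_mul]
  exact integrable_finsetSum _ fun i _ => integrable_finsetSum _ fun j _ =>
    (hγ.integrable_conj_mul i j).mul_const _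

lemma integral_linear_conjTranspose_mul (hγ : IsIndepStdComplexGaussian γ P)
    (φ : Matrix (Fin n) (Fin n) ℂ →ₗ[ℂ] ℂ) (y z : Fin d → Matrix (Fin n) (Fin n) ℂ) :
    ∫ ω, φ ((randomSum y γ ω)ᴴ * randomSum z γ ω) ∂P = φ (∑ i, (y i)ᴴ * z i) := by
  simp only [conjTranspose_randomSum_mul_randomSum, map_sum, map_smul, smul_eq_mul]
  rw [integral_finsetSum _ fun i _ => integrable_finsetSum _ fun j _ =>
    (hγ.integrable_conj_mul i j).mul_const _]
  refine Finset.sum_congr rfl fun i _ => ?_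
  rw [integral_finsetSum _ fun j _ => (hγ.integrable_conj_mul i j).mul_const _]
  simp only [integral_mul_const, hγ.integral_conj_mul]
  simp

lemma sq_conjTranspose_randomSum_mul_randomSum {Ω : Type*} {γ : Fin d → Ω → ℂ}
    (y : Fin d → Matrix (Fin n) (Fin n) ℂ) (ω : Ω) :
    (randomSum y γ ω)ᴴ * randomSum y γ ω * ((randomSum y γ ω)ᴴ * randomSum y γ ω) =
      ∑ i, ∑ j, ∑ k, ∑ l, (conj (γ i ω) * γ j ω * (conj (γ k ω) * γ l ω)) •
        ((y i)ᴴ * y j * ((y k)ᴴ * y l)) := by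
  rw [conjTranspose_randomSum_mul_randomSum]
  simp only [Finset.sum_mul]
  refine Finset.sum_congr rfl fun i _ => Finset.sum_congr rfl fun j _ => ?_
  simp only [Finset.mul_sum]
  refine Finset.sum_congr rfl fun k _ => Finset.sum_congr rfl fun l _ => ?_
  rw [smul_mul_smul_comm]

lemma integrable_linear_sq (hγ : IsIndepStdComplexGaussian γ P)
    (φ : Matrix (Fin n) (Fin n) ℂ →ₗ[ℂ] ℂ) (y : Fin d → Matrix (Fin n) (Fin n) ℂ) :
    Integrable (fun ω => φ ((randomSum y γ ω)ᴴ * randomSum y γ ω *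
      ((randomSum y γ ω)ᴴ * randomSum y γ ω))) P := by
  simp only [sq_conjTranspose_randomSum_mul_randomSum, map_sum, map_smul, smul_eq_mul]
  exact integrable_finsetSum _ fun i _ => integrable_finsetSum _ fun j _ =>
    integrable_finsetSum _ fun k _ => integrable_finsetSum _ fun l _ =>
    (hγ.integrable_conj_mul_mul_conj_mul i j k l).mul_const _

/-- The Wick formula for the fourth moment of a Gaussian random matrix. -/
lemma integral_linear_sq (hγ : IsIndepStdComplexGaussian γ P)
    (φ : Matrix (Fin n) (Fin n) ℂ →ₗ[ℂ] ℂ) (y : Fin d → Matrix (Fin n) (Fin n) ℂ) :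
    ∫ ω, φ ((randomSum y γ ω)ᴴ * randomSum y γ ω *
      ((randomSum y γ ω)ᴴ * randomSum y γ ω)) ∂P =
      φ ((∑ i, (y i)ᴴ * y i) * (∑ i, (y i)ᴴ * y i) +
        ∑ i, (y i)ᴴ * (∑ j, y j * (y j)ᴴ) * y i) := by
  simp only [sq_conjTranspose_randomSum_mul_randomSum, map_sum, map_smul, smul_eq_mul]
  have hi := fun i j k l => (hγ.integrable_conj_mul_mul_conj_mul i j k l).mul_const
    (φ ((y i)ᴴ * y j * ((y k)ᴴ * y l)))
  rw [integral_finsetSum _ fun i _ => integrable_finsetSum _ fun j _ =>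
    integrable_finsetSum _ fun k _ => integrable_finsetSum _ fun l _ => hi i j k l]
  have h1 : ∀ i, ∫ ω, ∑ j, ∑ k, ∑ l, (conj (γ i ω) * γ j ω * (conj (γ k ω) * γ l ω)) *
      φ ((y i)ᴴ * y j * ((y k)ᴴ * y l)) ∂P = ∑ k, φ ((y i)ᴴ * y i * ((y k)ᴴ * y k)) +
        ∑ j, φ ((y i)ᴴ * y j * ((y j)ᴴ * y i)) := by
    intro i
    rw [integral_finsetSum _ fun j _ =>
      integrable_finsetSum _ fun k _ => integrable_finsetSum _ fun l _ => hi i j k l]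
    have h2 : ∀ j, ∫ ω, ∑ k, ∑ l, (conj (γ i ω) * γ j ω * (conj (γ k ω) * γ l ω)) *
        φ ((y i)ᴴ * y j * ((y k)ᴴ * y l)) ∂P =
        (if i = j then ∑ k, φ ((y i)ᴴ * y j * ((y k)ᴴ * y k)) else 0) +
          φ ((y i)ᴴ * y j * ((y j)ᴴ * y i)) := by
      intro j
      rw [integral_finsetSum _ fun k _ => integrable_finsetSum _ fun l _ => hi i j k l]
      have h3 : ∀ k, ∫ ω, ∑ l, (conj (γ i ω) * γ j ω * (conj (γ k ω) * γ l ω)) *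
          φ ((y i)ᴴ * y j * ((y k)ᴴ * y l)) ∂P =
          (if i = j then φ ((y i)ᴴ * y j * ((y k)ᴴ * y k)) else 0) +
            (if j = k then φ ((y i)ᴴ * y j * ((y k)ᴴ * y i)) else 0) := by
        intro k
        rw [integral_finsetSum _ fun l _ => hi i j k l]
        simp only [integral_mul_const, hγ.integral_conj_mul_mul_conj_mul, add_mul,
          Finset.sum_add_distrib, ite_and, ite_mul, zero_mul, one_mul]
        congr 1
        · split_ifs <;> simp
        · simp
      simp only [h3, Finset.sum_add_distrib]
      congr 1
      · split_ifs <;> simp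
      · simp
    simp only [h2, Finset.sum_add_distrib]
    simp
  simp only [h1, Finset.sum_add_distrib]
  rw [map_add, Finset.sum_mul_sum]
  simp only [map_sum]
  congr 1
  simp only [Finset.mul_sum, Finset.sum_mul, map_sum, Matrix.mul_assoc]

/-- The linear functional `M ↦ u* M u`. -/
def _root_.NCKhintchine.quadraticForm (u : Fin n → ℂ) : Matrix (Fin n) (Fin n) ℂ →ₗ[ℂ] ℂ where
  toFun M := star u ⬝ᵥ (M *ᵥ u)
  map_add' M N := by rw [add_mulVec, dotProduct_add]
  map_smul' c M := by rw [smul_mulVec, dotProduct_smul, RingHom.id_apply]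

lemma integral_normSqVec (hγ : IsIndepStdComplexGaussian γ P)
    (y : Fin d → Matrix (Fin n) (Fin n) ℂ) (u : Fin n → ℂ) :
    Integrable (fun ω => normSqVec (randomSum y γ ω *ᵥ u)) P ∧
    ∫ ω, normSqVec (randomSum y γ ω *ᵥ u) ∂P = ∑ i, normSqVec (y i *ᵥ u) := by
  have h1 := hγ.integrable_linear_conjTranspose_mul (quadraticForm u) y y
  have h2 := hγ.integral_linear_conjTranspose_mul (quadraticForm u) y y
  simp only [quadraticForm, LinearMap.coe_mk, AddHom.coe_mk,
    star_dotProduct_conjTranspose_mul_mulVec, star_dotProduct_sum_mulVec] at h1 h2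
  rw [integral_complex_ofReal] at h2
  refine ⟨?_, Complex.ofReal_injective h2⟩
  simpa using h1.re

lemma conjTranspose_mul_mul_apply_self (C U : Matrix (Fin n) (Fin n) ℂ) (k : Fin n) :
    (Uᴴ * C * U) k k = star (U.col k) ⬝ᵥ (C *ᵥ U.col k) := by
  rw [Matrix.mul_assoc, Matrix.mul_apply, dotProduct]
  rfl

/-- The basis `U` is deterministic: it diagonalizes the mean of `Y* Y`, so bounding the random trace
in this basis and applying Jensen to each vector recovers exactly the eigenvalues of that mean. -/
lemma L1Norm_randomSum_le_trSqrt_col [IsProbabilityMeasure P]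
    (hγ : IsIndepStdComplexGaussian γ P) (y : Fin d → Matrix (Fin n) (Fin n) ℂ) :
    L1Norm P (randomSum y γ) ≤ trSqrt (∑ i, (y i)ᴴ * y i) := by
  obtain ⟨U, l, h1, h2, hl, hA⟩ := exists_unitary_diagonal (sum_conjTranspose_mul_self_posSemidef y)
  have hs := fun k => integral_sqrt_le (hγ.integral_normSqVec y (U.col k)).1
    fun _ => normSqVec_nonneg _
  have hle : ∀ ω, traceNorm (randomSum y γ ω) ≤
      ∑ k, Real.sqrt (normSqVec (randomSum y γ ω *ᵥ U.col k)) := by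
    intro ω
    refine (trSqrt_le_sum_sqrt (posSemidef_conjTranspose_mul_self _) h1 h2).trans_eq
      (Finset.sum_congr rfl fun k _ => ?_)
    rw [conjTranspose_mul_mul_apply_self, star_dotProduct_conjTranspose_mul_mulVec,
      Complex.ofReal_re]
  refine (integral_mono (hγ.integrable_traceNorm_randomSum y)
    (integrable_finsetSum _ fun k _ => (hs k).1) hle).trans ?_
  rw [integral_finsetSum _ fun k _ => (hs k).1]
  conv_rhs => rw [hA, trSqrt_unitary_diagonal h1 hl]
  refine Finset.sum_le_sum fun k _ => (hs k).2.trans_eq ?_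
  congr 1
  rw [(hγ.integral_normSqVec y (U.col k)).2]
  apply Complex.ofReal_injective
  rw [← star_dotProduct_sum_mulVec, ← conjTranspose_mul_mul_apply_self, hA, ← Matrix.mul_assoc,
    ← Matrix.mul_assoc, h1, Matrix.one_mul, Matrix.mul_assoc, h1, Matrix.mul_one,
    diagonal_apply_eq]

lemma L1Norm_randomSum_le_trSqrt_row [IsProbabilityMeasure P]
    (hγ : IsIndepStdComplexGaussian γ P) (z : Fin d → Matrix (Fin n) (Fin n) ℂ) :
    L1Norm P (randomSum z γ) ≤ trSqrt (∑ i, z i * (z i)ᴴ) := by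
  have h := hγ.conjugate.L1Norm_randomSum_le_trSqrt_col fun i => (z i)ᴴ
  simp only [conjTranspose_conjTranspose] at h
  refine le_of_eq_of_le (integral_congr_ae (Filter.Eventually.of_forall fun ω => ?_)) h
  dsimp only
  rw [← traceNorm_conjTranspose]
  simp [randomSum, conjTranspose_sum]

/-- The upper bound in the noncommutative Khintchine inequality, with constant `1`. -/
theorem L1Norm_randomSum_le_dualNorm [IsProbabilityMeasure P]
    (hγ : IsIndepStdComplexGaussian γ P) (x : Fin d → Matrix (Fin n) (Fin n) ℂ) :
    L1Norm P (randomSum x γ) ≤ dualNorm x := by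
  refine le_dualNorm ?_
  rintro y z rfl
  refine le_trans ?_ (add_le_add (hγ.L1Norm_randomSum_le_trSqrt_col y)
    (hγ.L1Norm_randomSum_le_trSqrt_row z))
  rw [L1Norm, L1Norm, L1Norm, ← integral_add (hγ.integrable_traceNorm_randomSum y)
    (hγ.integrable_traceNorm_randomSum z)]
  refine integral_mono (hγ.integrable_traceNorm_randomSum _)
    ((hγ.integrable_traceNorm_randomSum y).add (hγ.integrable_traceNorm_randomSum z)) fun ω => ?_
  have : randomSum (fun i => y i + z i) γ ω = randomSum y γ ω + randomSum z γ ω := by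
    simp [randomSum, Finset.sum_add_distrib]
  dsimp only
  rw [this]
  exact traceNorm_add_le _ _

end IsIndepStdComplexGaussian

end UpperBound
end NCKhintchine
end

noncomputable section
namespace NCKhintchine

open Matrix
open scoped MatrixOrder ComplexOrder ComplexConjugate

/-! ### The smooth truncation and its error. -/

section Truncation

variable {n : ℕ}

/-- The matrix `1 + Y* Y / 2`. -/
def truncDenominator (Y : Matrix (Fin n) (Fin n) ℂ) : Matrix (Fin n) (Fin n) ℂ :=
  1 + (1 / 2 : ℂ) • (Yᴴ * Y)

/-- The smooth truncation `Y (1 + Y* Y / 2)⁻¹`. -/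
def truncation (Y : Matrix (Fin n) (Fin n) ℂ) : Matrix (Fin n) (Fin n) ℂ :=
  Y * (truncDenominator Y)⁻¹

lemma posDef_truncDenominator (Y : Matrix (Fin n) (Fin n) ℂ) : (truncDenominator Y).PosDef :=
  PosDef.one.add_posSemidef ((posSemidef_conjTranspose_mul_self Y).smul (by
    rw [show (1 / 2 : ℂ) = ((1 / 2 : ℝ) : ℂ) by norm_num, Complex.zero_le_real]; norm_num))

lemma isUnit_det_truncDenominator (Y : Matrix (Fin n) (Fin n) ℂ) :
    IsUnit (truncDenominator Y).det :=
  (Matrix.isUnit_iff_isUnit_det _).1 (posDef_truncDenominator Y).isUnit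

lemma conjTranspose_truncation (Y : Matrix (Fin n) (Fin n) ℂ) :
    (truncation Y)ᴴ = truncation Yᴴ := by
  have h : Yᴴ * truncDenominator Yᴴ = truncDenominator Y * Yᴴ := by
    simp [truncDenominator, Matrix.mul_add, Matrix.add_mul, Matrix.mul_assoc]
  rw [truncation, conjTranspose_mul, conjTranspose_nonsing_inv,
    (posDef_truncDenominator Y).isHermitian.eq, truncation]
  have h1 := isUnit_det_truncDenominator Y
  have h2 := isUnit_det_truncDenominator Yᴴ
  calc (truncDenominator Y)⁻¹ * Yᴴ
      = (truncDenominator Y)⁻¹ * (Yᴴ * truncDenominator Yᴴ) * (truncDenominator Yᴴ)⁻¹ := by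
        rw [Matrix.mul_assoc, Matrix.mul_assoc Yᴴ, Matrix.mul_nonsing_inv _ h2, Matrix.mul_one]
    _ = _ := by
        rw [h, ← Matrix.mul_assoc, Matrix.nonsing_inv_mul _ h1, Matrix.one_mul]

/-- The truncation has operator norm at most `1 / √2`. -/
lemma posSemidef_one_sub_truncation (Y : Matrix (Fin n) (Fin n) ℂ) :
    (1 - (2 : ℂ) • ((truncation Y)ᴴ * truncation Y)).PosSemidef := by
  set D := truncDenominator Y with hD
  set K := D⁻¹ with hK
  set S := Yᴴ * Y with hS
  have hu := isUnit_det_truncDenominator Y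
  have hDs : Dᴴ = D := (posDef_truncDenominator Y).isHermitian.eq
  have hKs : Kᴴ = K := by rw [hK, conjTranspose_nonsing_inv, hDs]
  have hKD : K * D = 1 := Matrix.nonsing_inv_mul _ hu
  have hDK : D * K = 1 := Matrix.mul_nonsing_inv _ hu
  have hSs : Sᴴ = S := (isHermitian_conjTranspose_mul_self Y).eq
  -- Scalar form: `(1 + t²/2)² - 2t² = (1 - t²/2)²`, divided by `(1 + t²/2)²`.
  have e : 1 - (2 : ℂ) • ((truncation Y)ᴴ * truncation Y) =
      ((1 - (1 / 2 : ℂ) • S) * K)ᴴ * ((1 - (1 / 2 : ℂ) • S) * K) := by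
    have e1 : (truncation Y)ᴴ * truncation Y = K * S * K := by
      rw [truncation, ← hD, ← hK, conjTranspose_mul, hKs]
      simp only [hS, Matrix.mul_assoc]
    have e2 : (1 : Matrix (Fin n) (Fin n) ℂ) = K * (D * D) * K := by
      rw [← Matrix.mul_assoc, hKD, Matrix.one_mul, hDK]
    have hstar : (1 - (1 / 2 : ℂ) • S)ᴴ = 1 - (1 / 2 : ℂ) • S := by
      rw [conjTranspose_sub, conjTranspose_one, conjTranspose_smul, hSs]
      simp
    rw [e1, conjTranspose_mul, hKs, hstar]
    conv_lhs => rw [e2]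
    rw [← Matrix.smul_mul, ← Matrix.mul_smul, ← Matrix.sub_mul, ← Matrix.mul_sub,
      Matrix.mul_assoc K (1 - _), ← Matrix.mul_assoc (1 - _) (1 - _), ← Matrix.mul_assoc K]
    congr 2
    rw [hD, truncDenominator, ← hS]
    simp only [Matrix.mul_add, Matrix.add_mul, Matrix.mul_sub, Matrix.sub_mul, Matrix.mul_one,
      Matrix.one_mul, Matrix.smul_mul, Matrix.mul_smul]
    module
  rw [e]
  exact posSemidef_conjTranspose_mul_self _

/-- The truncation error is dominated by `(Y* Y)² / 8`. -/
lemma posSemidef_sq_sub_truncation_error (Y : Matrix (Fin n) (Fin n) ℂ) :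
    ((1 / 8 : ℂ) • (Yᴴ * Y * (Yᴴ * Y)) -
      (Y - truncation Y)ᴴ * (Y - truncation Y)).PosSemidef := by
  set D := truncDenominator Y with hD
  set K := D⁻¹ with hK
  set S := Yᴴ * Y with hS
  have hu := isUnit_det_truncDenominator Y
  have hDs : Dᴴ = D := (posDef_truncDenominator Y).isHermitian.eq
  have hKs : Kᴴ = K := by rw [hK, conjTranspose_nonsing_inv, hDs]
  have hKD : K * D = 1 := Matrix.nonsing_inv_mul _ hu
  have hDK : D * K = 1 := Matrix.mul_nonsing_inv _ hu
  have hSs : Sᴴ = S := (isHermitian_conjTranspose_mul_self Y).eq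
  have hR : Y - truncation Y = (1 / 2 : ℂ) • (Y * S * K) := by
    have : Y * D * K - Y * K = (1 / 2 : ℂ) • (Y * S * K) := by
      rw [← Matrix.sub_mul, ← Matrix.smul_mul, hD, truncDenominator, ← hS, Matrix.mul_add,
        Matrix.mul_one, Matrix.mul_smul, add_sub_cancel_left]
    rw [← this, Matrix.mul_assoc, hDK, Matrix.mul_one, truncation]
  have hRR : (Y - truncation Y)ᴴ * (Y - truncation Y) = (1 / 4 : ℂ) • (K * (S * S * S) * K) := by
    have : (Y * S * K)ᴴ = K * S * Yᴴ := by
      rw [conjTranspose_mul, conjTranspose_mul, hKs, hSs, ← Matrix.mul_assoc]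
    rw [hR, conjTranspose_smul, smul_mul_smul_comm, this]
    rw [show K * S * Yᴴ * (Y * S * K) = K * (S * S * S) * K by
      rw [hS]; simp only [Matrix.mul_assoc]]
    norm_num
  have hSS : S * S = K * (D * (S * S) * D) * K := by
    rw [show K * (D * (S * S) * D) * K = K * D * (S * S) * (D * K) by
      simp only [Matrix.mul_assoc], hKD, hDK, Matrix.one_mul, Matrix.mul_one]
  -- The same scalar identity multiplied by `t⁴/8`, as the error squared is `t⁶ / (4 (1 + t²/2)²)`.
  have e : (1 / 8 : ℂ) • (S * S) - (Y - truncation Y)ᴴ * (Y - truncation Y) =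
      (1 / 8 : ℂ) • ((S * (1 - (1 / 2 : ℂ) • S) * K)ᴴ * (S * (1 - (1 / 2 : ℂ) • S) * K)) := by
    have hstar : (1 - (1 / 2 : ℂ) • S)ᴴ = 1 - (1 / 2 : ℂ) • S := by
      rw [conjTranspose_sub, conjTranspose_one, conjTranspose_smul, hSs]
      simp
    have core : (1 / 8 : ℂ) • (D * (S * S) * D) - (1 / 4 : ℂ) • (S * S * S) =
        (1 / 8 : ℂ) • ((1 - (1 / 2 : ℂ) • S) * S * (S * (1 - (1 / 2 : ℂ) • S))) := by
      rw [hD, truncDenominator, ← hS]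
      simp only [Matrix.mul_add, Matrix.add_mul, Matrix.mul_sub, Matrix.sub_mul, Matrix.mul_one,
        Matrix.one_mul, Matrix.smul_mul, Matrix.mul_smul, Matrix.mul_assoc]
      module
    have core' := congrArg (fun M => K * M * K) core
    simp only [Matrix.mul_sub K, Matrix.sub_mul _ _ K, Matrix.mul_smul, Matrix.smul_mul _ _ K]
      at core'
    rw [hSS, hRR, conjTranspose_mul, conjTranspose_mul, hKs, hSs, hstar, core']
    simp only [Matrix.mul_assoc]
  rw [e]
  exact (posSemidef_conjTranspose_mul_self _).smul (by
    rw [show (1 / 8 : ℂ) = ((1 / 8 : ℝ) : ℂ) by norm_num, Complex.zero_le_real]; norm_num)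

lemma re_trace_truncation_mul_le (Y X : Matrix (Fin n) (Fin n) ℂ) :
    ((truncation Y)ᴴ * X).trace.re ≤ traceNorm X / Real.sqrt 2 := by
  have h := trace_re_le_traceNorm (B := ((Real.sqrt 2 : ℝ) : ℂ) • truncation Y) (by
    rw [conjTranspose_smul, smul_mul_smul_comm, Complex.star_def, Complex.conj_ofReal,
      ← Complex.ofReal_mul, Real.mul_self_sqrt zero_le_two]
    exact posSemidef_one_sub_truncation Y) X
  rw [conjTranspose_smul, Complex.star_def, Complex.conj_ofReal, Matrix.smul_mul, trace_smul,
    smul_eq_mul, Complex.re_ofReal_mul] at h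
  rwa [le_div_iff₀' (by positivity)]

lemma norm_truncation_apply_le (Y : Matrix (Fin n) (Fin n) ℂ) (m k : Fin n) :
    ‖truncation Y m k‖ ≤ 1 := by
  have h := (posSemidef_one_sub_truncation Y).diag_nonneg (i := k)
  rw [Matrix.sub_apply, Matrix.smul_apply, one_apply_eq] at h
  have h' := (Complex.le_def.1 h).1
  have h2 := re_sum_conjTranspose_mul_self_apply (fun _ : Unit => truncation Y) k
  simp only [Finset.univ_unique, Finset.sum_singleton, Fintype.sum_prod_type] at h2
  rw [Complex.sub_re, smul_eq_mul, show (2 : ℂ) = ((2 : ℝ) : ℂ) by norm_num,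
    Complex.re_ofReal_mul, h2] at h'
  simp only [Complex.zero_re, Complex.one_re] at h'
  have h3 := Finset.single_le_sum (f := fun m => ‖truncation Y m k‖ ^ 2)
    (fun _ _ => sq_nonneg _) (Finset.mem_univ m)
  nlinarith [norm_nonneg (truncation Y m k)]

lemma normSqVec_truncation_error_le (Y : Matrix (Fin n) (Fin n) ℂ) (u : Fin n → ℂ) :
    normSqVec ((Y - truncation Y) *ᵥ u) ≤
      1 / 8 * (quadraticForm u (Yᴴ * Y * (Yᴴ * Y))).re := by
  have h := (posSemidef_iff_dotProduct_mulVec.1 (posSemidef_sq_sub_truncation_error Y)).2 u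
  rw [sub_mulVec, dotProduct_sub, star_dotProduct_conjTranspose_mul_mulVec, smul_mulVec,
    dotProduct_smul, smul_eq_mul, show (1 / 8 : ℂ) = ((1 / 8 : ℝ) : ℂ) by norm_num] at h
  have h' := (Complex.le_def.1 h).1
  rw [Complex.sub_re, Complex.re_ofReal_mul, Complex.ofReal_re, Complex.zero_re] at h'
  simp only [quadraticForm, LinearMap.coe_mk, AddHom.coe_mk]
  linarith

lemma continuous_truncation :
    Continuous (truncation : Matrix (Fin n) (Fin n) ℂ → Matrix (Fin n) (Fin n) ℂ) := by
  have hD : Continuous (truncDenominator : Matrix (Fin n) (Fin n) ℂ → _) := by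
    unfold truncDenominator
    fun_prop
  unfold truncation
  refine continuous_id.matrix_mul ?_
  simp only [Matrix.inv_def, Ring.inverse_eq_inv']
  exact (hD.matrix_det.inv₀ fun Y => (isUnit_det_truncDenominator Y).ne_zero).smul
    hD.matrix_adjugate

end Truncation

/-! ### The lower Khintchine bound. -/

section LowerBound

variable {n d : ℕ} {Ω : Type*} [MeasurableSpace Ω] {P : Measure Ω} {γ : Fin d → Ω → ℂ}

lemma inner_toLp {f g : Ω → ℂ} (hf : MemLp f 2 P) (hg : MemLp g 2 P) :
    inner ℂ (hf.toLp f) (hg.toLp g) = ∫ ω, conj (f ω) * g ω ∂P := by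
  rw [L2.inner_def]
  refine integral_congr_ae ?_
  filter_upwards [hf.coeFn_toLp, hg.coeFn_toLp] with ω h1 h2
  rw [h1, h2, RCLike.inner_apply, mul_comm]

lemma norm_sq_toLp {f : Ω → ℂ} (hf : MemLp f 2 P) :
    ‖hf.toLp f‖ ^ 2 = ∫ ω, ‖f ω‖ ^ 2 ∂P := by
  have h := inner_self_eq_norm_sq_to_K (𝕜 := ℂ) (hf.toLp f)
  rw [inner_toLp] at h
  have e : ∀ ω, conj (f ω) * f ω = ((‖f ω‖ ^ 2 : ℝ) : ℂ) := fun ω => by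
    rw [← Complex.normSq_eq_conj_mul_self, Complex.normSq_eq_norm_sq]
  simp_rw [e] at h
  rw [integral_complex_ofReal] at h
  apply Complex.ofReal_injective
  rw [h]
  norm_cast

namespace IsIndepStdComplexGaussian

/-- Bessel's inequality for the Gaussian coefficients. -/
lemma sum_norm_sq_integral_le (hγ : IsIndepStdComplexGaussian γ P) {f : Ω → ℂ}
    (hf : MemLp f 2 P) :
    ∑ i, ‖∫ ω, conj (γ i ω) * f ω ∂P‖ ^ 2 ≤ ∫ ω, ‖f ω‖ ^ 2 ∂P := by
  have ho : Orthonormal ℂ fun i => (hγ.memLp_two i).toLp (γ i) := by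
    rw [orthonormal_iff_ite]
    intro i j
    rw [inner_toLp, hγ.integral_conj_mul]
  have h := ho.sum_inner_products_le (hf.toLp f) (s := Finset.univ)
  rw [norm_sq_toLp hf] at h
  simpa only [inner_toLp] using h

/-- Wick's formula gives `B² + ∑ b_i* C b_i`, where `B` and `C` are the column and row sums. The
column condition gives `B² ≤ B ≤ 1`, and the row condition `C ≤ 1` bounds the second term by `B ≤
1`. -/
lemma fourth_moment_le (hγ : IsIndepStdComplexGaussian γ P)
    {b : Fin d → Matrix (Fin n) (Fin n) ℂ} (hb : BiContractive b) (u : Fin n → ℂ) :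
    ∫ ω, (quadraticForm u ((randomSum b γ ω)ᴴ * randomSum b γ ω *
      ((randomSum b γ ω)ᴴ * randomSum b γ ω))).re ∂P ≤ 2 * normSqVec u := by
  have h := hγ.integral_linear_sq (quadraticForm u) b
  have hi := hγ.integrable_linear_sq (quadraticForm u) b
  have h' := congrArg Complex.re h
  rw [← RCLike.re_eq_complex_re, ← integral_re hi] at h'
  refine h'.trans_le ?_
  set B := ∑ i, (b i)ᴴ * b i with hB
  set C := ∑ j, b j * (b j)ᴴ with hC
  have h1 : (1 - B).PosSemidef := hb.1
  have h2 : (1 - C).PosSemidef := by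
    simpa only [ColContractive, conjTranspose_conjTranspose] using hb.2
  have hB0 : B.PosSemidef := sum_conjTranspose_mul_self_posSemidef b
  have h3 : (B - B * B).PosSemidef := by
    have e : B - B * B = Bᴴ * (1 - B) * B + (1 - B)ᴴ * B * (1 - B) := by
      rw [hB0.isHermitian.eq, h1.isHermitian.eq]
      noncomm_ring
    rw [e]
    exact (h1.conjTranspose_mul_mul_same B).add (hB0.conjTranspose_mul_mul_same _)
  have h4 : (B - ∑ i, (b i)ᴴ * C * b i).PosSemidef := by
    have e : B - ∑ i, (b i)ᴴ * C * b i = ∑ i, (b i)ᴴ * (1 - C) * b i := by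
      simp only [Matrix.mul_sub, Matrix.sub_mul, Matrix.mul_one, Finset.sum_sub_distrib, ← hB]
    rw [e]
    exact posSemidef_sum _ fun i _ => h2.conjTranspose_mul_mul_same (b i)
  have h5 : ((2 : ℂ) • 1 - (B * B + ∑ i, (b i)ᴴ * C * b i)).PosSemidef := by
    have e : (2 : ℂ) • 1 - (B * B + ∑ i, (b i)ᴴ * C * b i) =
        (1 - B) + (B - B * B) + ((1 - B) + (B - ∑ i, (b i)ᴴ * C * b i)) := by module
    rw [e]
    exact (h1.add h3).add (h1.add h4)
  have h6 := (posSemidef_iff_dotProduct_mulVec.1 h5).2 u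
  rw [sub_mulVec, dotProduct_sub, smul_mulVec, one_mulVec, dotProduct_smul,
    star_dotProduct_self, smul_eq_mul] at h6
  have h7 := (Complex.le_def.1 h6).1
  rw [Complex.sub_re, show (2 : ℂ) = ((2 : ℝ) : ℂ) by norm_num, Complex.re_ofReal_mul,
    Complex.ofReal_re, Complex.zero_re] at h7
  simp only [quadraticForm, LinearMap.coe_mk, AddHom.coe_mk, RCLike.re_eq_complex_re]
  linarith

lemma aestronglyMeasurable_comp (hγ : IsIndepStdComplexGaussian γ P)
    {E : Type*} [TopologicalSpace E] [TopologicalSpace.PseudoMetrizableSpace E]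
    {f : (Fin d → ℂ) → E} (hf : Continuous f) : AEStronglyMeasurable (fun ω => f fun i => γ i ω) P :=
  hf.comp_aestronglyMeasurable hγ.aemeasurable_pi.aestronglyMeasurable

lemma memLp_truncation_error [IsFiniteMeasure P] (hγ : IsIndepStdComplexGaussian γ P)
    (b : Fin d → Matrix (Fin n) (Fin n) ℂ) (m k : Fin n) :
    MemLp (fun ω => (randomSum b γ ω - truncation (randomSum b γ ω)) m k) 2 P := by
  have h1 : MemLp (fun ω => randomSum b γ ω m k) 2 P := by
    simp only [randomSum, Matrix.sum_apply, Matrix.smul_apply, smul_eq_mul]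
    exact memLp_finsetSum _ fun i _ => (hγ.memLp_two i).mul_const _
  have hc : Continuous fun c : Fin d → ℂ => truncation (∑ i, c i • b i) m k :=
    (continuous_truncation.comp (by fun_prop)).matrix_elem m k
  have h2 : MemLp (fun ω => truncation (randomSum b γ ω) m k) 2 P :=
    MemLp.of_bound (hγ.aestronglyMeasurable_comp hc) 1
      (Filter.Eventually.of_forall fun ω => norm_truncation_apply_le _ m k)
  exact h1.sub h2

/-- The Gaussian coefficients of the truncation error. -/
def _root_.NCKhintchine.errorCoefficient (P : Measure Ω) (γ : Fin d → Ω → ℂ)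
    (b : Fin d → Matrix (Fin n) (Fin n) ℂ) (i : Fin d) : Matrix (Fin n) (Fin n) ℂ :=
  Matrix.of fun m k =>
    ∫ ω, conj (γ i ω) * (randomSum b γ ω - truncation (randomSum b γ ω)) m k ∂P

/-- Bessel, applied to each coordinate of `R u`, bounds the left side by `E ‖R u‖²`; the constant is
`1/8 * 2`, from the truncation error and the fourth moment. -/
lemma sum_normSqVec_errorCoefficient_le [IsFiniteMeasure P] (hγ : IsIndepStdComplexGaussian γ P)
    {b : Fin d → Matrix (Fin n) (Fin n) ℂ} (hb : BiContractive b) (u : Fin n → ℂ) :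
    ∑ i, normSqVec (errorCoefficient P γ b i *ᵥ u) ≤ 1 / 4 * normSqVec u := by
  set R : Ω → Matrix (Fin n) (Fin n) ℂ :=
    fun ω => randomSum b γ ω - truncation (randomSum b γ ω) with hR
  have hRm : ∀ m, MemLp (fun ω => (R ω *ᵥ u) m) 2 P := fun m => by
    simp only [mulVec, dotProduct]
    exact memLp_finsetSum _ fun k _ => (hγ.memLp_truncation_error b m k).mul_const _
  have he : ∀ i m, (errorCoefficient P γ b i *ᵥ u) m =
      ∫ ω, conj (γ i ω) * (R ω *ᵥ u) m ∂P := by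
    intro i m
    have hk : ∀ k, Integrable (fun ω => conj (γ i ω) * R ω m k * u k) P := fun k =>
      ((hγ.memLp_two i).star.integrable_mul (hγ.memLp_truncation_error b m k)).mul_const _
    simp only [errorCoefficient, mulVec, dotProduct, Matrix.of_apply, Finset.mul_sum, ← mul_assoc]
    rw [integral_finsetSum _ fun k _ => hk k]
    exact Finset.sum_congr rfl fun k _ => (integral_mul_const _ _).symm
  have h1 : ∑ i, normSqVec (errorCoefficient P γ b i *ᵥ u) ≤
      ∑ m, ∫ ω, ‖(R ω *ᵥ u) m‖ ^ 2 ∂P := by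
    simp only [normSqVec, he]
    rw [Finset.sum_comm]
    exact Finset.sum_le_sum fun m _ => hγ.sum_norm_sq_integral_le (hRm m)
  have hint : ∀ m, Integrable (fun ω => ‖(R ω *ᵥ u) m‖ ^ 2) P := fun m =>
    (memLp_two_iff_integrable_sq_norm (hRm m).1).1 (hRm m)
  rw [← integral_finsetSum _ fun m _ => hint m] at h1
  refine h1.trans ?_
  have hi := (hγ.integrable_linear_sq (quadraticForm u) b).re.const_mul (1 / 8)
  have h2 := integral_mono (integrable_finsetSum Finset.univ fun m _ => hint m) hi
    fun ω => normSqVec_truncation_error_le (randomSum b γ ω) u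
  refine h2.trans ?_
  rw [integral_const_mul]
  have h3 := hγ.fourth_moment_le hb u
  simp only [RCLike.re_eq_complex_re] at h3 ⊢
  linarith

/-- Truncation commutes with the adjoint, so the row estimate for the error coefficients is the
column estimate for the adjoint family and the conjugate Gaussians. -/
lemma errorCoefficient_conjTranspose (b : Fin d → Matrix (Fin n) (Fin n) ℂ) (i : Fin d) :
    errorCoefficient P (fun i ω => conj (γ i ω)) (fun i => (b i)ᴴ) i =
      (errorCoefficient P γ b i)ᴴ := by
  ext m k
  have hY : ∀ ω, randomSum (fun i => (b i)ᴴ) (fun i ω => conj (γ i ω)) ω =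
      (randomSum b γ ω)ᴴ := by
    intro ω
    simp [randomSum, conjTranspose_sum]
  simp only [errorCoefficient, Matrix.of_apply, conjTranspose_apply, hY, Complex.star_def]
  rw [← integral_conj]
  refine integral_congr_ae (Filter.Eventually.of_forall fun ω => ?_)
  simp only [map_mul, ← conjTranspose_truncation, ← conjTranspose_sub, conjTranspose_apply,
    Complex.star_def]

lemma biContractive_errorCoefficient [IsFiniteMeasure P] (hγ : IsIndepStdComplexGaussian γ P)
    {b : Fin d → Matrix (Fin n) (Fin n) ℂ} (hb : BiContractive b) :
    BiContractive fun i => (2 : ℂ) • errorCoefficient P γ b i := by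
  have key : ∀ c : Fin d → Matrix (Fin n) (Fin n) ℂ,
      (∀ u, ∑ i, normSqVec (c i *ᵥ u) ≤ 1 / 4 * normSqVec u) →
      ColContractive fun i => (2 : ℂ) • c i := by
    intro c hc
    rw [colContractive_iff]
    intro u
    have : ∀ i, normSqVec (((2 : ℂ) • c i) *ᵥ u) = 4 * normSqVec (c i *ᵥ u) := by
      intro i
      rw [smul_mulVec, normSqVec, normSqVec, Finset.mul_sum]
      refine Finset.sum_congr rfl fun k _ => ?_
      rw [Pi.smul_apply, norm_smul, mul_pow]
      norm_num
    simp only [this, ← Finset.mul_sum]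
    linarith [hc u]
  refine ⟨key _ (hγ.sum_normSqVec_errorCoefficient_le hb), ?_⟩
  have hb' : BiContractive fun i => (b i)ᴴ := ⟨hb.2, by simpa using hb.1⟩
  have h := key _ (hγ.conjugate.sum_normSqVec_errorCoefficient_le hb')
  simp only [errorCoefficient_conjTranspose] at h
  simpa using h

lemma integral_trace_error_mul [IsFiniteMeasure P] (hγ : IsIndepStdComplexGaussian γ P)
    (b x : Fin d → Matrix (Fin n) (Fin n) ℂ) :
    Integrable (fun ω => ((randomSum b γ ω - truncation (randomSum b γ ω))ᴴ *
      randomSum x γ ω).trace) P ∧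
    ∫ ω, ((randomSum b γ ω - truncation (randomSum b γ ω))ᴴ * randomSum x γ ω).trace ∂P =
      ∑ i, ((errorCoefficient P γ b i)ᴴ * x i).trace := by
  set R : Ω → Matrix (Fin n) (Fin n) ℂ :=
    fun ω => randomSum b γ ω - truncation (randomSum b γ ω) with hR
  have e : ∀ ω, ((R ω)ᴴ * randomSum x γ ω).trace =
      ∑ i, ∑ k, ∑ m, conj (conj (γ i ω) * R ω m k) * x i m k := by
    intro ω
    rw [randomSum, Finset.mul_sum, trace_sum]
    refine Finset.sum_congr rfl fun i _ => ?_
    rw [trace_conjTranspose_mul]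
    refine Finset.sum_congr rfl fun k _ => Finset.sum_congr rfl fun m _ => ?_
    simp only [Matrix.smul_apply, smul_eq_mul, map_mul, Complex.conj_conj, Complex.star_def]
    ring
  have hi : ∀ i k m, Integrable (fun ω => conj (conj (γ i ω) * R ω m k) * x i m k) P :=
    fun i k m => Integrable.mul_const ((Complex.conjCLE : ℂ →L[ℝ] ℂ).integrable_comp
      ((hγ.memLp_two i).star.integrable_mul (hγ.memLp_truncation_error b m k))) _
  constructor
  · simp only [hR] at e ⊢
    simp_rw [e]
    exact integrable_finsetSum _ fun i _ => integrable_finsetSum _ fun k _ =>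
      integrable_finsetSum _ fun m _ => hi i k m
  · simp only [hR] at e ⊢
    simp_rw [e]
    rw [integral_finsetSum _ fun i _ => integrable_finsetSum _ fun k _ =>
      integrable_finsetSum _ fun m _ => hi i k m]
    refine Finset.sum_congr rfl fun i _ => ?_
    rw [integral_finsetSum _ fun k _ => integrable_finsetSum _ fun m _ => hi i k m,
      trace_conjTranspose_mul]
    refine Finset.sum_congr rfl fun k _ => ?_
    rw [integral_finsetSum _ fun m _ => hi i k m]
    refine Finset.sum_congr rfl fun m _ => ?_
    rw [integral_mul_const, integral_conj]
    rfl

/-- The lower bound in the noncommutative Khintchine inequality, with constant `1 / √2`. -/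
theorem dualNorm_le_L1Norm_randomSum [IsProbabilityMeasure P]
    (hγ : IsIndepStdComplexGaussian γ P) (x : Fin d → Matrix (Fin n) (Fin n) ℂ) :
    1 / Real.sqrt 2 * dualNorm x ≤ L1Norm P (randomSum x γ) := by
  obtain ⟨b, hb, hbx⟩ := exists_biContractive_pairing_eq x
  have h2 := (hγ.biContractive_errorCoefficient hb).pairing_le x
  have h3 : pairing (fun i => (2 : ℂ) • errorCoefficient P γ b i) x =
      2 * pairing (errorCoefficient P γ b) x := by
    simp [pairing, trace_smul, ← Finset.mul_sum]
  have hY := hγ.integral_linear_conjTranspose_mul (Matrix.traceLinearMap (Fin n) ℂ ℂ) b x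
  have hYi := hγ.integrable_linear_conjTranspose_mul (Matrix.traceLinearMap (Fin n) ℂ ℂ) b x
  simp only [Matrix.traceLinearMap_apply, trace_sum] at hY hYi
  obtain ⟨hRi, hR⟩ := hγ.integral_trace_error_mul b x
  have hz : ∀ ω, ((truncation (randomSum b γ ω))ᴴ * randomSum x γ ω).trace =
      ((randomSum b γ ω)ᴴ * randomSum x γ ω).trace -
        ((randomSum b γ ω - truncation (randomSum b γ ω))ᴴ * randomSum x γ ω).trace := by
    intro ω
    rw [← trace_sub, ← Matrix.sub_mul, ← conjTranspose_sub, sub_sub_cancel]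
  have hzi : Integrable (fun ω =>
      ((truncation (randomSum b γ ω))ᴴ * randomSum x γ ω).trace) P := by
    simp_rw [hz]
    exact hYi.sub hRi
  have hzint : ∫ ω, ((truncation (randomSum b γ ω))ᴴ * randomSum x γ ω).trace ∂P =
      ∑ i, ((b i)ᴴ * x i).trace - ∑ i, ((errorCoefficient P γ b i)ᴴ * x i).trace := by
    simp_rw [hz]
    rw [integral_sub hYi hRi, hY, hR]
  have hle := integral_mono hzi.re ((hγ.integrable_traceNorm_randomSum x).div_const (Real.sqrt 2))
    fun ω => re_trace_truncation_mul_le (randomSum b γ ω) (randomSum x γ ω)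
  rw [integral_re hzi, hzint, integral_div, map_sub] at hle
  have h4 : pairing b x - pairing (errorCoefficient P γ b) x ≤
      L1Norm P (randomSum x γ) / Real.sqrt 2 := hle
  -- The error pairing is at most `dualNorm x / 2` and is absorbed on the left.
  have h5 : dualNorm x ≤ 2 * (L1Norm P (randomSum x γ) / Real.sqrt 2) := by linarith
  have h6 : (2 : ℝ) = Real.sqrt 2 * Real.sqrt 2 := (Real.mul_self_sqrt zero_le_two).symm
  have h7 : 0 < Real.sqrt 2 := by positivity
  rw [one_div, inv_mul_le_iff₀ h7]
  refine h5.trans_eq ?_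
  nth_rewrite 1 [h6]
  field_simp

end IsIndepStdComplexGaussian
end LowerBound
end NCKhintchine
end

noncomputable section
namespace NCKhintchine

open Matrix
open scoped MatrixOrder ComplexOrder ComplexConjugate

/-! ### Optimality of the upper constant: one column of matrix units. -/

section UpperSharpness

variable {n d : ℕ}

lemma trSqrt_smul_single (i : Fin n) {s : ℝ} (hs : 0 ≤ s) :
    trSqrt ((s : ℂ) • Matrix.single i i (1 : ℂ)) = Real.sqrt s := by
  have hp : (Matrix.single i i (1 : ℂ)).PosSemidef := by
    have h := posSemidef_conjTranspose_mul_self (Matrix.single i i (1 : ℂ))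
    rwa [conjTranspose_single, single_mul_single_same, star_one, one_mul] at h
  have h1 : trSqrt (Matrix.single i i (1 : ℂ)) = 1 := by
    rw [trSqrt_of_mul_self hp one_pos (by simp)]
    simp
  have h := trSqrt_smul hp (Real.sqrt_nonneg s)
  rwa [Real.sq_sqrt hs, h1, mul_one] at h

variable {Ω : Type*} [MeasurableSpace Ω] {P : Measure Ω} {γ : Fin d → Ω → ℂ}

lemma conj_mul_self_eq (z : ℂ) : conj z * z = ((‖z‖ ^ 2 : ℝ) : ℂ) := by
  rw [← Complex.normSq_eq_conj_mul_self, Complex.normSq_eq_norm_sq]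

namespace IsIndepStdComplexGaussian

lemma integrable_sum_norm_sq (hγ : IsIndepStdComplexGaussian γ P) :
    Integrable (fun ω => ∑ i, ‖γ i ω‖ ^ 2) P :=
  integrable_finsetSum _ fun i _ => hγ.integrable_norm_pow i 2

lemma integral_sum_norm_sq (hγ : IsIndepStdComplexGaussian γ P) :
    ∫ ω, ∑ i, ‖γ i ω‖ ^ 2 ∂P = d := by
  rw [integral_finsetSum _ fun i _ => hγ.integrable_norm_pow i 2]
  have : ∀ i, ∫ ω, ‖γ i ω‖ ^ 2 ∂P = 1 := by
    intro i
    have h := hγ.integral_conj_mul i i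
    simp only [conj_mul_self_eq] at h
    rw [integral_complex_ofReal] at h
    simpa using h
  simp [this]

lemma sq_sum_norm_sq (hγ : IsIndepStdComplexGaussian γ P) :
    Integrable (fun ω => (∑ i, ‖γ i ω‖ ^ 2) ^ 2) P ∧
    ∫ ω, (∑ i, ‖γ i ω‖ ^ 2) ^ 2 ∂P = d ^ 2 + d := by
  have e : ∀ ω, (∑ i, ‖γ i ω‖ ^ 2) ^ 2 = ∑ i, ∑ k, ‖γ i ω‖ ^ 2 * ‖γ k ω‖ ^ 2 := fun ω => by
    rw [sq, Finset.sum_mul_sum]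
  have hi : ∀ i k, Integrable (fun ω => ‖γ i ω‖ ^ 2 * ‖γ k ω‖ ^ 2) P := by
    intro i k
    have h := (hγ.integrable_conj_mul_mul_conj_mul i i k k).re
    simp only [conj_mul_self_eq, ← Complex.ofReal_mul, RCLike.re_eq_complex_re,
      Complex.ofReal_re] at h
    exact h
  have hm : ∀ i k, ∫ ω, ‖γ i ω‖ ^ 2 * ‖γ k ω‖ ^ 2 ∂P = 1 + if i = k then 1 else 0 := by
    intro i k
    have h := hγ.integral_conj_mul_mul_conj_mul i i k k
    simp only [conj_mul_self_eq, ← Complex.ofReal_mul] at h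
    rw [integral_complex_ofReal] at h
    apply Complex.ofReal_injective
    rw [h]
    split_ifs <;> simp_all
  simp_rw [e]
  refine ⟨integrable_finsetSum _ fun i _ => integrable_finsetSum _ fun k _ => hi i k, ?_⟩
  rw [integral_finsetSum _ fun i _ => integrable_finsetSum _ fun k _ => hi i k]
  have : ∀ i, ∫ ω, ∑ k, ‖γ i ω‖ ^ 2 * ‖γ k ω‖ ^ 2 ∂P = d + 1 := by
    intro i
    rw [integral_finsetSum _ fun k _ => hi i k]
    simp [hm, Finset.sum_add_distrib]
  simp only [this, Finset.sum_const, Finset.card_univ, Fintype.card_fin, nsmul_eq_mul]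
  ring

lemma integral_sqrt_sum_norm_sq_le [IsProbabilityMeasure P] (hγ : IsIndepStdComplexGaussian γ P) :
    Integrable (fun ω => Real.sqrt (∑ i, ‖γ i ω‖ ^ 2)) P ∧
    ∫ ω, Real.sqrt (∑ i, ‖γ i ω‖ ^ 2) ∂P ≤ Real.sqrt d := by
  have h := integral_sqrt_le hγ.integrable_sum_norm_sq
    fun ω => Finset.sum_nonneg fun i _ => sq_nonneg _
  rwa [hγ.integral_sum_norm_sq] at h

/-- A lower bound for `r` by a polynomial in `r²` touching it at `r = √d` reduces the estimate to `E
r² = d` and `E r⁴ = d² + d`. -/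
lemma le_integral_sqrt_sum_norm_sq [IsProbabilityMeasure P] (hγ : IsIndepStdComplexGaussian γ P)
    (hd : 0 < d) :
    Real.sqrt d * (1 - 1 / (2 * d)) ≤ ∫ ω, Real.sqrt (∑ i, ‖γ i ω‖ ^ 2) ∂P := by
  have hd' : (0 : ℝ) < d := Nat.cast_pos.2 hd
  have hs := Real.sqrt_pos.2 hd'
  have hss := Real.sq_sqrt hd'.le
  have hle : ∀ ω, 3 / (2 * Real.sqrt d) * (∑ i, ‖γ i ω‖ ^ 2) -
      1 / (2 * d * Real.sqrt d) * (∑ i, ‖γ i ω‖ ^ 2) ^ 2 ≤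
      Real.sqrt (∑ i, ‖γ i ω‖ ^ 2) := by
    intro ω
    set r := Real.sqrt (∑ i, ‖γ i ω‖ ^ 2) with hr
    have hr0 : 0 ≤ r := Real.sqrt_nonneg _
    have hr2 : ∑ i, ‖γ i ω‖ ^ 2 = r ^ 2 :=
      (Real.sq_sqrt (Finset.sum_nonneg fun i _ => sq_nonneg _)).symm
    rw [hr2]
    set t := Real.sqrt d with ht
    rw [← hss]
    -- The double root at `r = t` expresses the tangency; the remaining factor `r + 2t` is
    -- nonnegative.
    have e : r - (3 / (2 * t) * r ^ 2 - 1 / (2 * t ^ 2 * t) * (r ^ 2) ^ 2) =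
        r * ((r - t) ^ 2 * (r + 2 * t)) / (2 * t ^ 3) := by
      field_simp
      ring
    have : 0 ≤ r * ((r - t) ^ 2 * (r + 2 * t)) / (2 * t ^ 3) := by positivity
    linarith
  have h1 := hγ.integrable_sum_norm_sq.const_mul (3 / (2 * Real.sqrt d))
  have h2 := hγ.sq_sum_norm_sq.1.const_mul (1 / (2 * d * Real.sqrt d))
  have h := integral_mono (h1.sub h2) hγ.integral_sqrt_sum_norm_sq_le.1 hle
  refine le_trans (le_of_eq ?_) h
  have h3 := integral_sub h1 h2
  rw [integral_const_mul, integral_const_mul, hγ.integral_sum_norm_sq, hγ.sq_sum_norm_sq.2] at h3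
  refine Eq.trans ?_ h3.symm
  set t := Real.sqrt d with ht
  rw [← hss]
  field_simp
  ring

end IsIndepStdComplexGaussian

/-- The matrix units of the first column. -/
def firstColumn (k : ℕ) (i : Fin (k + 1)) : Matrix (Fin (k + 1)) (Fin (k + 1)) ℂ :=
  Matrix.single i 0 1

lemma firstColumn_conjTranspose_mul (k : ℕ) (i j : Fin (k + 1)) :
    (firstColumn k i)ᴴ * firstColumn k j = if i = j then Matrix.single 0 0 1 else 0 := by
  rw [firstColumn, firstColumn, conjTranspose_single, star_one]
  split_ifs with h
  · subst h
    simp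
  · exact single_mul_single_of_ne _ _ _ _ h _

lemma dualNorm_firstColumn_le (k : ℕ) :
    dualNorm (firstColumn k) ≤ Real.sqrt ((k + 1 : ℕ) : ℝ) := by
  refine (dualNorm_le_trSqrt_col _).trans_eq ?_
  rw [← trSqrt_smul_single (0 : Fin (k + 1)) (Nat.cast_nonneg _)]
  simp only [firstColumn_conjTranspose_mul, if_true, Finset.sum_const, Finset.card_univ,
    Fintype.card_fin]
  rw [Complex.ofReal_natCast, Nat.cast_smul_eq_nsmul]

lemma traceNorm_randomSum_firstColumn {Ω : Type*} (k : ℕ) (γ : Fin (k + 1) → Ω → ℂ) (ω : Ω) :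
    traceNorm (randomSum (firstColumn k) γ ω) = Real.sqrt (∑ i, ‖γ i ω‖ ^ 2) := by
  rw [traceNorm, IsIndepStdComplexGaussian.conjTranspose_randomSum_mul_randomSum,
    ← trSqrt_smul_single (0 : Fin (k + 1)) (Finset.sum_nonneg fun i _ => sq_nonneg _)]
  congr 1
  simp only [firstColumn_conjTranspose_mul, smul_ite, smul_zero, Finset.sum_ite_eq,
    Finset.mem_univ, if_true, conj_mul_self_eq]
  rw [← Finset.sum_smul, Complex.ofReal_sum]

end UpperSharpness

/-! ### Construction of fermionic annihilation operators. -/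

section Fermions

/-- Annihilation operators of a fermionic Fock space: the matrices `a i` satisfy the canonical
anticommutation relations and lower by one the particle number `ν` of the basis vectors. -/
structure IsFermionic {ι : Type*} [Fintype ι] [DecidableEq ι] {d : ℕ} (a : Fin d → Matrix ι ι ℂ)
    (ν : ι → ℕ) : Prop where
  anticomm : ∀ i j, a i * a j + a j * a i = 0
  anticomm_star : ∀ i j, a i * (a j)ᴴ + (a j)ᴴ * a i = if i = j then 1 else 0
  lowers : ∀ i s t, a i s t ≠ 0 → ν t = ν s + 1
  number : ∑ i, (a i)ᴴ * a i = diagonal fun s => (ν s : ℂ)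
  card_level : ∀ k, (Finset.univ.filter fun s => ν s = k).card = d.choose k

lemma IsFermionic.submatrix {ι κ : Type*} [Fintype ι] [DecidableEq ι] [Fintype κ] [DecidableEq κ]
    {d : ℕ} {a : Fin d → Matrix ι ι ℂ} {ν : ι → ℕ} (h : IsFermionic a ν) (e : κ ≃ ι) :
    IsFermionic (fun i => (a i).submatrix e e) (ν ∘ e) where
  anticomm i j := by
    rw [submatrix_mul_equiv, submatrix_mul_equiv]
    exact congrArg (fun M : Matrix ι ι ℂ => M.submatrix e e) (h.anticomm i j)
  anticomm_star i j := by
    rw [conjTranspose_submatrix, submatrix_mul_equiv, submatrix_mul_equiv]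
    refine (congrArg (fun M : Matrix ι ι ℂ => M.submatrix e e) (h.anticomm_star i j)).trans ?_
    split_ifs
    · exact submatrix_one_equiv e
    · rfl
  lowers i s t hst := h.lowers i _ _ hst
  number := by
    have := congrArg (fun M => M.submatrix e e) h.number
    simp only [submatrix_diagonal_equiv] at this
    simp only [conjTranspose_submatrix, submatrix_mul_equiv]
    refine Eq.trans ?_ this
    ext s t
    simp [Matrix.sum_apply]
  card_level k := by
    rw [← h.card_level k]
    refine Finset.card_equiv e fun s => ?_
    simp

/-- Jordan–Wigner step: the two blocks are the states with the new mode empty and occupied. The sign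
on the second block makes the old modes anticommute with the new one, and level sizes obey Pascal's
rule. -/
lemma IsFermionic.succ {ι : Type*} [Fintype ι] [DecidableEq ι] {d : ℕ} {a : Fin d → Matrix ι ι ℂ}
    {ν : ι → ℕ} (h : IsFermionic a ν) :
    IsFermionic (Fin.cons (fromBlocks 0 1 0 0) fun i => fromBlocks (a i) 0 0 (-a i) :
      Fin (d + 1) → Matrix (ι ⊕ ι) (ι ⊕ ι) ℂ) (Sum.elim ν fun s => ν s + 1) where
  anticomm i j := by
    refine Fin.cases ?_ (fun i => ?_) i <;> refine Fin.cases ?_ (fun j => ?_) j <;>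
      simp [fromBlocks_multiply, fromBlocks_add, h.anticomm]
  anticomm_star i j := by
    refine Fin.cases ?_ (fun i => ?_) i <;> refine Fin.cases ?_ (fun j => ?_) j
    · simp [fromBlocks_multiply, fromBlocks_add, fromBlocks_conjTranspose, fromBlocks_one]
    · simp [fromBlocks_multiply, fromBlocks_add, fromBlocks_conjTranspose,
        (Fin.succ_ne_zero j).symm]
    · simp [fromBlocks_multiply, fromBlocks_add, fromBlocks_conjTranspose]
    · simp only [Fin.cons_succ, fromBlocks_multiply, fromBlocks_add, fromBlocks_conjTranspose,
        Fin.succ_inj]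
      simp only [conjTranspose_zero, conjTranspose_neg, Matrix.mul_zero, Matrix.zero_mul,
        neg_mul_neg, add_zero, zero_add, h.anticomm_star]
      split_ifs <;> simp [fromBlocks_one]
  lowers i s t := by
    refine Fin.cases ?_ (fun i => ?_) i
    · rcases s with s | s <;> rcases t with t | t <;> simp [Matrix.one_apply]
      rintro rfl
      rfl
    · rcases s with s | s <;> rcases t with t | t <;> simp
      · exact h.lowers i s t
      · exact h.lowers i s t
  number := by
    rw [Fin.sum_univ_succ]
    simp only [Fin.cons_zero, Fin.cons_succ, fromBlocks_conjTranspose, fromBlocks_multiply]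
    have : ∑ i, (fromBlocks ((a i)ᴴ * a i) 0 0 ((a i)ᴴ * a i) : Matrix (ι ⊕ ι) (ι ⊕ ι) ℂ) =
        fromBlocks (diagonal fun s => (ν s : ℂ)) 0 0 (diagonal fun s => (ν s : ℂ)) := by
      rw [← h.number]
      ext s t
      rcases s with s | s <;> rcases t with t | t <;> simp [Matrix.sum_apply]
    simp only [conjTranspose_zero, conjTranspose_one, conjTranspose_neg, Matrix.mul_zero,
      Matrix.zero_mul, neg_mul_neg, add_zero, zero_add, Matrix.mul_one, this, fromBlocks_add]
    ext s t
    rcases s with s | s <;> rcases t with t | t <;>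
      simp [diagonal_apply, Matrix.one_apply]
    split_ifs <;> simp [add_comm]
  card_level k := by
    have hsum : (Finset.univ.filter fun s => Sum.elim ν (fun s => ν s + 1) s = k).card =
        (Finset.univ.filter fun s => ν s = k).card +
          (Finset.univ.filter fun s => ν s + 1 = k).card := by
      simp only [Finset.card_filter, Fintype.sum_sum_type]
      exact congrArg₂ (· + ·) (Finset.sum_congr rfl fun s _ => if_congr Iff.rfl rfl rfl)
        (Finset.sum_congr rfl fun s _ => if_congr Iff.rfl rfl rfl)
    rw [hsum]
    rcases k with _ | k
    · simp [h.card_level]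
    · simp [h.card_level, Nat.choose_succ_succ, add_comm]

lemma exists_isFermionic (d : ℕ) :
    ∃ (ι : Type) (_ : Fintype ι) (_ : DecidableEq ι) (a : Fin d → Matrix ι ι ℂ) (ν : ι → ℕ),
      IsFermionic a ν := by
  induction d with
  | zero =>
    -- With no modes there is only the vacuum, at level `0`.
    refine ⟨Unit, inferInstance, inferInstance, Fin.elim0, fun _ => 0, ?_⟩
    refine ⟨fun i => i.elim0, fun i => i.elim0, fun i => i.elim0, by simp, fun k => ?_⟩
    rcases k with _ | k
    · simp
    · simp
  | succ d ih =>
    obtain ⟨ι, _, _, a, ν, h⟩ := ih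
    exact ⟨ι ⊕ ι, inferInstance, inferInstance, _, _, h.succ⟩

end Fermions
end NCKhintchine
end

noncomputable section
namespace NCKhintchine

open Matrix
open scoped MatrixOrder ComplexOrder ComplexConjugate

/-! ### Fermionic test matrices for the lower constant. -/

section LowerSharpness

variable {n d : ℕ}

/-- The projection onto the span of the basis vectors with particle number `k`. -/
def levelProjection (ν : Fin n → ℕ) (k : ℕ) : Matrix (Fin n) (Fin n) ℂ :=
  diagonal fun s => if ν s = k then 1 else 0

lemma conjTranspose_levelProjection (ν : Fin n → ℕ) (k : ℕ) :
    (levelProjection ν k)ᴴ = levelProjection ν k := by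
  rw [levelProjection, diagonal_conjTranspose]
  congr 1
  ext s
  simp only [Pi.star_apply]
  split_ifs <;> simp

lemma levelProjection_mul_self (ν : Fin n → ℕ) (k : ℕ) :
    levelProjection ν k * levelProjection ν k = levelProjection ν k := by
  rw [levelProjection, diagonal_mul_diagonal]
  congr 1
  ext s
  split_ifs <;> simp

lemma posSemidef_one_sub_levelProjection (ν : Fin n → ℕ) (k : ℕ) :
    (1 - levelProjection ν k).PosSemidef := by
  rw [levelProjection, ← diagonal_one, diagonal_sub]
  apply PosSemidef.diagonal
  intro s
  simp only [Pi.zero_apply]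
  split_ifs <;> simp

lemma diagonal_mul_levelProjection (ν : Fin n → ℕ) (k : ℕ) :
    (diagonal fun s => (ν s : ℂ)) * levelProjection ν k = (k : ℂ) • levelProjection ν k := by
  rw [levelProjection, diagonal_mul_diagonal, ← diagonal_smul]
  congr 1
  ext s
  simp only [Pi.smul_apply, smul_eq_mul]
  split_ifs with h
  · rw [h]
  · simp

namespace IsFermionic

variable {a : Fin d → Matrix (Fin n) (Fin n) ℂ} {ν : Fin n → ℕ}

lemma trace_levelProjection (h : IsFermionic a ν) (k : ℕ) :
    (levelProjection ν k).trace = d.choose k := by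
  rw [levelProjection, trace_diagonal, Finset.sum_boole, h.card_level]

lemma mul_levelProjection_succ (h : IsFermionic a ν) (i : Fin d) (k : ℕ) :
    a i * levelProjection ν (k + 1) = levelProjection ν k * a i := by
  ext s t
  rw [levelProjection, levelProjection, mul_diagonal, diagonal_mul]
  by_cases h0 : a i s t = 0
  · simp [h0]
  · have := h.lowers i s t h0
    simp [this]

lemma mul_levelProjection_zero (h : IsFermionic a ν) (i : Fin d) :
    a i * levelProjection ν 0 = 0 := by
  ext s t
  rw [levelProjection, mul_diagonal]
  by_cases h0 : a i s t = 0
  · simp [h0]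
  · have := h.lowers i s t h0
    simp [this]

/-- The annihilation operator of the vector `c`. -/
def _root_.NCKhintchine.annihilation (a : Fin d → Matrix (Fin n) (Fin n) ℂ) (c : Fin d → ℂ) :
    Matrix (Fin n) (Fin n) ℂ := ∑ i, c i • a i

lemma annihilation_mul_levelProjection_succ (h : IsFermionic a ν) (c : Fin d → ℂ) (k : ℕ) :
    annihilation a c * levelProjection ν (k + 1) = levelProjection ν k * annihilation a c := by
  simp only [annihilation, Finset.sum_mul, Finset.mul_sum, Matrix.smul_mul, Matrix.mul_smul,
    h.mul_levelProjection_succ]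

lemma annihilation_mul_levelProjection_zero (h : IsFermionic a ν) (c : Fin d → ℂ) :
    annihilation a c * levelProjection ν 0 = 0 := by
  simp [annihilation, Finset.sum_mul, h.mul_levelProjection_zero]

lemma levelProjection_mul_conjTranspose_annihilation (h : IsFermionic a ν) (c : Fin d → ℂ)
    (k : ℕ) : (annihilation a c)ᴴ * levelProjection ν k =
      levelProjection ν (k + 1) * (annihilation a c)ᴴ := by
  have := congrArg conjTranspose (h.annihilation_mul_levelProjection_succ c k)
  simpa only [conjTranspose_mul, conjTranspose_levelProjection] using this.symm

lemma annihilation_mul_self (h : IsFermionic a ν) (c : Fin d → ℂ) :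
    annihilation a c * annihilation a c = 0 := by
  have e : annihilation a c * annihilation a c + annihilation a c * annihilation a c = 0 := by
    rw [annihilation, Finset.sum_mul_sum]
    conv_lhs => enter [2]; rw [Finset.sum_comm]
    simp only [← Finset.sum_add_distrib]
    refine Finset.sum_eq_zero fun i _ => Finset.sum_eq_zero fun j _ => ?_
    rw [smul_mul_smul_comm, smul_mul_smul_comm, mul_comm (c j), ← smul_add, h.anticomm, smul_zero]
  rw [← two_smul ℂ] at e
  exact (smul_eq_zero.1 e).resolve_left two_ne_zero

lemma annihilation_anticomm_star (h : IsFermionic a ν) (c : Fin d → ℂ) :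
    annihilation a c * (annihilation a c)ᴴ + (annihilation a c)ᴴ * annihilation a c =
      ((∑ i, ‖c i‖ ^ 2 : ℝ) : ℂ) • 1 := by
  rw [annihilation, conjTranspose_sum, Finset.sum_mul_sum, Finset.sum_mul_sum]
  conv_lhs => enter [2]; rw [Finset.sum_comm]
  simp only [← Finset.sum_add_distrib]
  have : ∀ i j, c i • a i * (c j • a j)ᴴ + (c j • a j)ᴴ * c i • a i =
      if i = j then ((‖c i‖ ^ 2 : ℝ) : ℂ) • (1 : Matrix (Fin n) (Fin n) ℂ) else 0 := by
    intro i j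
    rw [conjTranspose_smul, smul_mul_smul_comm, smul_mul_smul_comm, mul_comm (c i), ← smul_add,
      h.anticomm_star]
    split_ifs with hij
    · rw [← hij, Complex.star_def, conj_mul_self_eq]
    · rw [smul_zero]
  simp only [this, Finset.sum_ite_eq, Finset.mem_univ, if_true]
  rw [← Finset.sum_smul, Complex.ofReal_sum]

/-- Replace `A A*` by `s - A* A` and use `A² = 0`: thus `A` is `√s` times a partial isometry. -/
lemma annihilation_mul_star_mul (h : IsFermionic a ν) (c : Fin d → ℂ) :
    annihilation a c * (annihilation a c)ᴴ * annihilation a c =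
      ((∑ i, ‖c i‖ ^ 2 : ℝ) : ℂ) • annihilation a c := by
  rw [eq_sub_of_add_eq (h.annihilation_anticomm_star c), Matrix.sub_mul, Matrix.mul_assoc _ _
    (annihilation a c), h.annihilation_mul_self, Matrix.mul_zero, sub_zero, Matrix.smul_mul,
    Matrix.one_mul]

end IsFermionic

/-- The annihilation operators restricted to the level `k + 1`. -/
def levelAnnihilation (a : Fin d → Matrix (Fin n) (Fin n) ℂ) (ν : Fin n → ℕ) (k : ℕ)
    (i : Fin d) : Matrix (Fin n) (Fin n) ℂ :=
  a i * levelProjection ν (k + 1)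

namespace IsFermionic

variable {ν : Fin n → ℕ}

/-- Cyclicity moves the trace on level `j + 1` to `Tr (A A* P_j)`. Adding `Tr (A* A P_j)` gives `s`
times the dimension of level `j`, so Pascal's rule solves the recursion. -/
lemma trace_annihilation_star_mul {a : Fin (d + 1) → Matrix (Fin n) (Fin n) ℂ}
    (h : IsFermionic a ν) (c : Fin (d + 1) → ℂ) (k : ℕ) :
    ((annihilation a c)ᴴ * annihilation a c * levelProjection ν (k + 1)).trace =
      ((∑ i, ‖c i‖ ^ 2 : ℝ) : ℂ) * d.choose k := by
  set s : ℂ := ((∑ i, ‖c i‖ ^ 2 : ℝ) : ℂ) with hs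
  have key : ∀ j, ((annihilation a c)ᴴ * annihilation a c * levelProjection ν j).trace +
      ((annihilation a c)ᴴ * annihilation a c * levelProjection ν (j + 1)).trace =
      s * (d + 1).choose j := by
    intro j
    have e : ((annihilation a c)ᴴ * annihilation a c * levelProjection ν (j + 1)).trace =
        (annihilation a c * (annihilation a c)ᴴ * levelProjection ν j).trace := by
      rw [Matrix.mul_assoc, h.annihilation_mul_levelProjection_succ, ← Matrix.mul_assoc,
        Matrix.trace_mul_comm, Matrix.mul_assoc]
    rw [e, ← trace_add, ← Matrix.add_mul, add_comm, h.annihilation_anticomm_star,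
      Matrix.smul_mul, Matrix.one_mul, trace_smul, h.trace_levelProjection, smul_eq_mul]
  induction k with
  | zero =>
    have h0 := key 0
    rw [Matrix.mul_assoc, h.annihilation_mul_levelProjection_zero, Matrix.mul_zero, trace_zero,
      zero_add] at h0
    rw [h0]
    simp
  | succ k ih =>
    have h1 := key (k + 1)
    rw [ih, Nat.choose_succ_succ] at h1
    push_cast at h1
    linear_combination h1

/-- The square `(A P)* (A P) = A* A P` is `s` times a projection, so its root has trace `Tr (A* A P)
/ √s`. The case `s = 0` is separate because of the division. -/
lemma traceNorm_randomSum {Ω : Type*} {a : Fin (d + 1) → Matrix (Fin n) (Fin n) ℂ}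
    (h : IsFermionic a ν) (γ : Fin (d + 1) → Ω → ℂ) (k : ℕ) (ω : Ω) :
    traceNorm (randomSum (levelAnnihilation a ν k) γ ω) =
      Real.sqrt (∑ i, ‖γ i ω‖ ^ 2) * d.choose k := by
  set A := annihilation a fun i => γ i ω with hA
  set s : ℝ := ∑ i, ‖γ i ω‖ ^ 2 with hs
  have hX : randomSum (levelAnnihilation a ν k) γ ω = A * levelProjection ν (k + 1) := by
    simp only [randomSum, levelAnnihilation, hA, annihilation, Finset.sum_mul, Matrix.smul_mul]
  have hXX : (A * levelProjection ν (k + 1))ᴴ * (A * levelProjection ν (k + 1)) =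
      Aᴴ * A * levelProjection ν (k + 1) := by
    rw [conjTranspose_mul, conjTranspose_levelProjection,
      ← h.levelProjection_mul_conjTranspose_annihilation, Matrix.mul_assoc,
      ← Matrix.mul_assoc (levelProjection ν k), ← h.annihilation_mul_levelProjection_succ,
      Matrix.mul_assoc A, levelProjection_mul_self, Matrix.mul_assoc]
  have hs0 : 0 ≤ s := Finset.sum_nonneg fun i _ => sq_nonneg _
  rw [hX, traceNorm]
  have hps := posSemidef_conjTranspose_mul_self (A * levelProjection ν (k + 1))
  rw [hXX] at hps ⊢
  rcases hs0.eq_or_lt with h0 | h0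
  · have hz : A = 0 := by
      have hi : ∀ i, γ i ω = 0 := by
        intro i
        have := (Finset.sum_eq_zero_iff_of_nonneg fun i _ => sq_nonneg _).1 h0.symm i
          (Finset.mem_univ i)
        simpa using this
      simp [hA, annihilation, hi]
    rw [hz, ← h0]
    simp [trSqrt_zero]
  · have hcomm : levelProjection ν (k + 1) * (Aᴴ * A) = Aᴴ * A * levelProjection ν (k + 1) := by
      rw [← Matrix.mul_assoc, ← h.levelProjection_mul_conjTranspose_annihilation, Matrix.mul_assoc,
        ← h.annihilation_mul_levelProjection_succ, Matrix.mul_assoc]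
    rw [trSqrt_of_mul_self hps (Real.sqrt_pos.2 h0), h.trace_annihilation_star_mul]
    · rw [← Complex.ofReal_natCast, ← Complex.ofReal_mul, Complex.ofReal_re, ← hs, mul_div_right_comm,
        Real.div_sqrt]
    · rw [Real.sq_sqrt hs0, Matrix.mul_assoc, ← Matrix.mul_assoc (levelProjection ν (k + 1)), hcomm,
        Matrix.mul_assoc (Aᴴ * A) (levelProjection ν (k + 1)), levelProjection_mul_self,
        ← Matrix.mul_assoc, Matrix.mul_assoc Aᴴ A, ← Matrix.mul_assoc A,
        h.annihilation_mul_star_mul, Matrix.mul_smul, Matrix.smul_mul]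

lemma sum_star_mul_levelAnnihilation {a : Fin d → Matrix (Fin n) (Fin n) ℂ} (h : IsFermionic a ν)
    (k : ℕ) : ∑ i, (levelAnnihilation a ν k i)ᴴ * levelAnnihilation a ν k i =
      ((k + 1 : ℕ) : ℂ) • levelProjection ν (k + 1) := by
  simp only [levelAnnihilation]
  rw [sum_conjTranspose_mul_unitary, h.number, conjTranspose_levelProjection, Matrix.mul_assoc,
    diagonal_mul_levelProjection, Matrix.mul_smul, levelProjection_mul_self]

/-- This sum counts empty modes: on level `d` there are `(2d + 1) - d = d + 1`, as many as occupied
modes on level `d + 1`. The odd number of modes balances row and column sums. -/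
lemma sum_levelAnnihilation_mul_star {a : Fin (2 * d + 1) → Matrix (Fin n) (Fin n) ℂ}
    (h : IsFermionic a ν) :
    ∑ i, levelAnnihilation a ν d i * (levelAnnihilation a ν d i)ᴴ =
      ((d + 1 : ℕ) : ℂ) • levelProjection ν d := by
  have h1 : ∑ i, a i * (a i)ᴴ = ((2 * d + 1 : ℕ) : ℂ) • 1 - diagonal fun s => (ν s : ℂ) := by
    rw [← h.number, eq_sub_iff_add_eq, ← Finset.sum_add_distrib]
    simp only [h.anticomm_star, if_true, Finset.sum_const, Finset.card_univ, Fintype.card_fin]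
    rw [Nat.cast_smul_eq_nsmul]
  have h2 : ∀ i, levelAnnihilation a ν d i * (levelAnnihilation a ν d i)ᴴ =
      levelProjection ν d * (a i * (a i)ᴴ) * levelProjection ν d := by
    intro i
    rw [levelAnnihilation, h.mul_levelProjection_succ, conjTranspose_mul,
      conjTranspose_levelProjection]
    simp only [Matrix.mul_assoc]
  simp only [h2]
  rw [← Finset.sum_mul, ← Finset.mul_sum, h1, Matrix.mul_assoc, Matrix.sub_mul,
    diagonal_mul_levelProjection, Matrix.smul_mul, Matrix.one_mul, ← sub_smul, Matrix.mul_smul,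
    levelProjection_mul_self]
  congr 1
  push_cast
  ring

/-- The family is paired with itself divided by `√(d + 1)`, which is bicontractive by the two
preceding sums. -/
lemma le_dualNorm_levelAnnihilation {a : Fin (2 * d + 1) → Matrix (Fin n) (Fin n) ℂ}
    (h : IsFermionic a ν) :
    Real.sqrt (d + 1) * (2 * d + 1).choose (d + 1) ≤ dualNorm (levelAnnihilation a ν d) := by
  have hd : (0 : ℝ) < d + 1 := by positivity
  have hs := Real.sqrt_pos.2 hd
  set r : ℂ := (((Real.sqrt (d + 1))⁻¹ : ℝ) : ℂ) with hr
  have hrs : star r = r := Complex.conj_ofReal _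
  have hrr : r * r * ((d + 1 : ℕ) : ℂ) = 1 := by
    rw [hr, ← Complex.ofReal_natCast, ← Complex.ofReal_mul, ← Complex.ofReal_mul, ← mul_inv,
      Real.mul_self_sqrt hd.le]
    push_cast
    rw [inv_mul_cancel₀]
    exact_mod_cast hd.ne'
  have hb : BiContractive fun i => r • levelAnnihilation a ν d i := by
    constructor
    · simp only [ColContractive, conjTranspose_smul, smul_mul_smul_comm, hrs]
      rw [← Finset.smul_sum, h.sum_star_mul_levelAnnihilation, smul_smul, hrr, one_smul]
      exact posSemidef_one_sub_levelProjection _ _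
    · simp only [ColContractive, conjTranspose_conjTranspose, conjTranspose_smul,
        smul_mul_smul_comm, hrs]
      rw [← Finset.smul_sum, h.sum_levelAnnihilation_mul_star, smul_smul, hrr, one_smul]
      exact posSemidef_one_sub_levelProjection _ _
  refine le_of_eq_of_le ?_ (hb.pairing_le _)
  simp only [pairing, conjTranspose_smul, hrs, Matrix.smul_mul]
  rw [← trace_sum, ← Finset.smul_sum, h.sum_star_mul_levelAnnihilation, trace_smul, trace_smul,
    h.trace_levelProjection, hr, smul_eq_mul, smul_eq_mul, ← Complex.ofReal_natCast,
    ← Complex.ofReal_natCast, ← Complex.ofReal_mul, ← Complex.ofReal_mul, Complex.ofReal_re]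
  push_cast
  rw [← mul_assoc, inv_mul_eq_div, Real.div_sqrt]

end IsFermionic

lemma exists_fin_isFermionic (d : ℕ) :
    ∃ (n : ℕ) (a : Fin d → Matrix (Fin n) (Fin n) ℂ) (ν : Fin n → ℕ), 0 < n ∧
      IsFermionic a ν := by
  obtain ⟨ι, _, _, a, ν, h⟩ := exists_isFermionic d
  refine ⟨_, _, _, ?_, h.submatrix (Fintype.equivFin ι).symm⟩
  rw [Fintype.card_pos_iff]
  have h0 := h.card_level 0
  rw [Nat.choose_zero_right] at h0
  obtain ⟨s, -⟩ := Finset.card_pos.1 (h0 ▸ one_pos)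
  exact ⟨s⟩

end LowerSharpness

/-! ### Bounds on admissible constants and the main theorem. -/

section BestConstants

variable {Ω : Type*} [MeasurableSpace Ω] {P : Measure Ω} [IsProbabilityMeasure P]

/-- The fermionic test matrices give an upper bound for the constant in the lower estimate. -/
lemma IsIndepStdComplexGaussian.sq_mul_le_of_lower_bound {d : ℕ} {γ : Fin (2 * d + 1) → Ω → ℂ}
    (hγ : IsIndepStdComplexGaussian γ P) {c : ℝ} (hc0 : 0 ≤ c)
    (hc : ∀ n : ℕ, 0 < n → ∀ x : Fin (2 * d + 1) → Matrix (Fin n) (Fin n) ℂ,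
      c * dualNorm x ≤ L1Norm P (randomSum x γ)) :
    c ^ 2 * (2 * d + 1) ≤ d + 1 := by
  obtain ⟨n, a, ν, hn, h⟩ := exists_fin_isFermionic (2 * d + 1)
  have h1 := hc n hn (levelAnnihilation a ν d)
  have h2 := mul_le_mul_of_nonneg_left h.le_dualNorm_levelAnnihilation hc0
  have h3 : L1Norm P (randomSum (levelAnnihilation a ν d) γ) ≤
      Real.sqrt (2 * d + 1) * (2 * d).choose d := by
    simp only [L1Norm, h.traceNorm_randomSum γ d]
    rw [integral_mul_const]
    refine mul_le_mul_of_nonneg_right ?_ (Nat.cast_nonneg _)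
    have := hγ.integral_sqrt_sum_norm_sq_le.2
    push_cast at this
    exact this
  have h4 := h2.trans (h1.trans h3)
  -- This ratio of the binomials turns `√(2d+1) C(2d,d) / (√(d+1) C(2d+1,d+1))` into
  -- `√((d+1)/(2d+1))`.
  have h5 : ((2 * d + 1 : ℕ) : ℝ) * (2 * d).choose d = (2 * d + 1).choose (d + 1) * (d + 1 : ℕ) := by
    exact_mod_cast Nat.add_one_mul_choose_eq (2 * d) d
  push_cast at h5
  have hC : (0 : ℝ) < (2 * d).choose d := by
    exact_mod_cast Nat.choose_pos (by omega)
  set C : ℝ := ((2 * d).choose d : ℝ)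
  set C' : ℝ := ((2 * d + 1).choose (d + 1) : ℝ)
  set p := Real.sqrt (d + 1) with hp
  set q := Real.sqrt (2 * d + 1) with hq
  have hp2 : p ^ 2 = d + 1 := Real.sq_sqrt (by positivity)
  have hq2 : q ^ 2 = 2 * d + 1 := Real.sq_sqrt (by positivity)
  have hp0 : 0 < p := Real.sqrt_pos.2 (by positivity)
  have hq0 : 0 < q := Real.sqrt_pos.2 (by positivity)
  rw [← hp2, ← hq2] at h5 ⊢
  have h6 : c * q ≤ p := by
    have h7 : c * (p * C') * p = c * q ^ 2 * C := by rw [mul_assoc, mul_assoc c]; rw [h5]; ring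
    have h8 : c * q ^ 2 * C ≤ q * C * p := h7 ▸ mul_le_mul_of_nonneg_right h4 hp0.le
    have h9 : (c * q) * (q * C) ≤ p * (q * C) := by linarith
    exact le_of_mul_le_mul_right h9 (mul_pos hq0 hC)
  have h10 : 0 ≤ c * q := by positivity
  rw [← mul_pow]
  exact pow_le_pow_left₀ h10 h6 2

/-- The first column matrix units give a lower bound for the constant in the upper estimate. -/
lemma IsIndepStdComplexGaussian.le_of_upper_bound {k : ℕ} {γ : Fin (k + 1) → Ω → ℂ}
    (hγ : IsIndepStdComplexGaussian γ P) {c : ℝ}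
    (hc : L1Norm P (randomSum (firstColumn k) γ) ≤ c * dualNorm (firstColumn k)) :
    1 - 1 / (2 * ((k : ℝ) + 1)) ≤ c := by
  simp only [L1Norm, traceNorm_randomSum_firstColumn] at hc
  have h1 := (hγ.le_integral_sqrt_sum_norm_sq k.succ_pos).trans hc
  have hs : 0 < Real.sqrt ((k + 1 : ℕ) : ℝ) := Real.sqrt_pos.2 (by positivity)
  have hk : 1 / (2 * ((k : ℝ) + 1)) < 1 := by
    rw [div_lt_one (by positivity)]
    linarith [(Nat.cast_nonneg k : (0 : ℝ) ≤ k)]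
  push_cast at h1
  -- The sign of `c` is needed before `dualNorm` can be replaced by its upper bound.
  have hc0 : 0 ≤ c := by
    by_contra hneg
    have h2 := mul_nonpos_of_nonpos_of_nonneg (not_le.1 hneg).le (dualNorm_nonneg (firstColumn k))
    push_cast at hs
    have h3 := mul_pos hs (sub_pos.2 hk)
    linarith
  have h4 := h1.trans (mul_le_mul_of_nonneg_left (dualNorm_firstColumn_le k) hc0)
  push_cast at h4 hs
  rw [mul_comm c] at h4
  exact le_of_mul_le_mul_left h4 hs

end BestConstants
end NCKhintchine
end

theorem mainTheorem2 {Ω : ℕ → Type*} [∀ d, MeasurableSpace (Ω d)]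
    (P : (d : ℕ) → Measure (Ω d)) [∀ d, IsProbabilityMeasure (P d)]
    (γ : (d : ℕ) → Fin d → Ω d → ℂ)
    (hγ : ∀ d, NCKhintchine.IsIndepStdComplexGaussian (γ d) (P d)) :
    (∀ d n : ℕ, 0 < d → 0 < n → ∀ x : Fin d → Matrix (Fin n) (Fin n) ℂ,
      Integrable (fun ω => NCKhintchine.traceNorm (NCKhintchine.randomSum x (γ d) ω)) (P d)) ∧
    IsGreatest {c : ℝ | ∀ d n : ℕ, 0 < d → 0 < n → ∀ x : Fin d → Matrix (Fin n) (Fin n) ℂ,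
      c * NCKhintchine.dualNorm x ≤
        NCKhintchine.L1Norm (P d) (NCKhintchine.randomSum x (γ d))} (1 / Real.sqrt 2) ∧
    IsLeast {c : ℝ | ∀ d n : ℕ, 0 < d → 0 < n → ∀ x : Fin d → Matrix (Fin n) (Fin n) ℂ,
      NCKhintchine.L1Norm (P d) (NCKhintchine.randomSum x (γ d)) ≤
        c * NCKhintchine.dualNorm x} 1 := by
  refine ⟨fun d n _ _ x => (hγ d).integrable_traceNorm_randomSum x,
    ⟨fun d n _ _ x => (hγ d).dualNorm_le_L1Norm_randomSum x, fun c hc => ?_⟩,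
    ⟨fun d n _ _ x => ?_, fun c hc => ?_⟩⟩
  · rcases le_or_gt c 0 with h0 | h0
    · exact h0.trans (by positivity)
    · have h1 : ∀ k : ℕ, c ^ 2 * (2 * k + 1) ≤ k + 1 := fun k =>
        (hγ (2 * k + 1)).sq_mul_le_of_lower_bound h0.le fun n hn x => hc _ n (by omega) hn x
      have h2 : c ^ 2 ≤ 1 / 2 := by
        by_contra hlt
        -- The bound reads `k (2c² - 1) ≤ 1 - c²`, which fails for this `k`.
        obtain ⟨k, hk⟩ := exists_nat_gt (1 / (2 * c ^ 2 - 1))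
        have hpos : 0 < 2 * c ^ 2 - 1 := by linarith
        rw [div_lt_iff₀ hpos] at hk
        nlinarith [h1 k]
      rw [one_div, ← Real.sqrt_inv]
      exact Real.le_sqrt_of_sq_le (by linarith)
  · rw [one_mul]
    exact (hγ d).L1Norm_randomSum_le_dualNorm x
  · by_contra hlt
    have hpos : 0 < 1 - c := by linarith [not_le.1 hlt]
    obtain ⟨k, hk⟩ := exists_nat_gt (1 / (1 - c))
    have h := (hγ (k + 1)).le_of_upper_bound (hc _ _ k.succ_pos k.succ_pos _)
    rw [div_lt_iff₀ hpos] at hk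
    have hk0 : (0 : ℝ) ≤ k := Nat.cast_nonneg k
    have h3 : 1 - c ≤ 1 / (2 * ((k : ℝ) + 1)) := by linarith
    rw [le_div_iff₀ (by positivity)] at h3
    nlinarith
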